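/- Let $n\ge 1$, $\gamma\in(0,1)$, $T>0$, $\tau>0$, $s>0$, $p>0$ and $M>0$. Write $\widehat f(\xi)=(2\pi)^{-n/2}\int_{\mathbb R^n}f(x)e^{-ix\cdot\xi}\,dx$ for the Fourier transform on $L^2(\mathbb R^n)$, $\|f\|_{H^r}=\|(1+|\xi|^2)^{r/2}\widehat f\|_{L^2}$ for the norm of the Sobolev space $H^r(\mathbb R^n)$, and $E_{\gamma,1}(z)=\sum_{k\ge0}z^k/\Gamma(\gamma k+1)$ for the Mittag-Leffler function. Let $\varphi$ be the kernel with $\widehat\varphi(\xi)=(2\pi)^{-n/2}\exp(-\tau|\xi|^s)$. There is a constant $C>0$, depending only on $n,\gamma,T,\tau,s,p,M$, such that the following holds for all $E>0$, $\delta\ge 0$ with $\delta\le ME$, and $0\le h\le 1/2$. Let $u\in C([0,T],L^2(\mathbb R^n))\cap C((0,T],H^2(\mathbb R^n))$ be the solution of the final value problem $$\frac{\partial^\gamma u}{\partial t^\gamma}=\Delta u\quad\text{on }\mathbb R^n\times(0,T),\qquad u(\cdot,T)=g,$$ where $\frac{\partial^\gamma u}{\partial t^\gamma}(t)=\frac1{\Gamma(1-\gamma)}\int_0^t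 (t-r)^{-\gamma}u'(r)\,dr$ is the Caputo derivative and the equation holds in $L^2(\mathbb R^n)$ for every $t\in(0,T)$. Assume that $u(\cdot,0)\in H^p(\mathbb R^n)$ with $\|u(\cdot,0)\|_{H^p}\le E$. Let $g^\delta\in L^2(\mathbb R^n)$ satisfy $\|g-g^\delta\|_{L^2}\le\delta$, and let $\psi_h$ be a positive function on $[0,\infty)\times(0,T]$ with $$\left\|\frac{\psi_h(|\xi|,t)-E_{\gamma,1}(-|\xi|^2t^\gamma)}{E_{\gamma,1}(-|\xi|^2t^\gamma)}\right\|_{L^\infty(\mathbb R^n)}\le h\qquad\text{for all }t\in(0,T].$$ Put $\alpha=(h+\delta/E)^{1/(p+2)}$. Then there is exactly one $u^{\delta,h}_\alpha(\cdot,0)\in L^2(\mathbb R^n)$ with $$\widehat{u^{\delta,h}_\alpha}(\xi,0)=(2\pi)^{n/2}\,\widehat\varphi(\alpha\xi)\,\frac{\widehat{g^\delta}(\xi)}{\psi_h(|\xi|,T)},$$ and for every $l\in[0,p]$ with $p-l\le s$, $$\|u(\cdot,0)-u^{\delta,h}_\alpha(\cdot,0)\|_{H^l}\le C\,E^{\frac{2+l}{p+2}}\,(\delta+hE)^{\frac{p-l}{p+2}}.$$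 -/

import Mathlib

open MeasureTheory Set Filter Topology
open scoped ENNReal FourierTransform SchwartzMap Laplacian

noncomputable section

namespace FracDiffusion

/-- The space `ℝⁿ` with its Euclidean norm. -/
abbrev Rn (n : ℕ) : Type := EuclideanSpace ℝ (Fin n)

/-- The complex Hilbert space `L²(ℝⁿ)`. -/
abbrev L2 (n : ℕ) : Type := Lp ℂ 2 (volume : Measure (Rn n))

/-- The Mittag-Leffler function `E_{γ,1}` on the real line. -/
def mittagLeffler (γ : ℝ) (x : ℝ) : ℝ :=
  ∑' k : ℕ, x ^ k / Real.Gamma (γ * k + 1)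

/-- The unitary Fourier transform
`f̂(ξ) = (2π)^{-n/2} ∫ f(x) e^{-i x·ξ} dx` of `f ∈ L²(ℝⁿ)`, as a function defined almost everywhere.
Mathlib's transform `𝓕` has the kernel `e^{-2πi x·η}`, whence the rescaling `η = ξ / (2π)`. -/
def fourierHat {n : ℕ} (f : L2 n) (ξ : Rn n) : ℂ :=
  (((√(2 * Real.pi)) ^ n)⁻¹ : ℝ) • (𝓕 f : L2 n) ((2 * Real.pi)⁻¹ • ξ)

/-- The norm of `H^r(ℝⁿ)`, that is `‖(1 + |ξ|²)^{r/2} f̂‖_{L²}`, with the value `∞` for those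
`f ∈ L²(ℝⁿ)` that do not belong to `H^r(ℝⁿ)`. -/
def sobolevNorm {n : ℕ} (r : ℝ) (f : L2 n) : ℝ≥0∞ :=
  eLpNorm (fun ξ : Rn n => (((1 + ‖ξ‖ ^ 2) ^ (r / 2) : ℝ) : ℂ) * fourierHat f ξ) 2 volume

/-- The Caputo derivative of order `γ` of a curve in `L²(ℝⁿ)`, as a Bochner integral. -/
def caputoDeriv {n : ℕ} (γ : ℝ) (u : ℝ → L2 n) (t : ℝ) : L2 n :=
  (1 / Real.Gamma (1 - γ)) • ∫ s in (0 : ℝ)..t, ((t - s) ^ (-γ) : ℝ) • deriv u s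

/-- `u` is a (weak) solution of `∂^γ u / ∂t^γ = Δ u` on `ℝⁿ × (0,T)` with `u(·,T) = g`:
it lies in `C([0,T], L²) ∩ C((0,T], H²)`, and the equation holds in `L²(ℝⁿ)` at each `t ∈ (0,T)`,
where the Laplacian is the distributional one. -/
structure IsSolution {n : ℕ} (γ T : ℝ) (g : L2 n) (u : ℝ → L2 n) : Prop where
  continuousOn : ContinuousOn u (Icc 0 T)
  mem_H2 : ∀ t ∈ Ioc 0 T, sobolevNorm 2 (u t) < ∞
  continuousOn_H2 : ∀ t ∈ Ioc 0 T,
    Tendsto (fun t' => sobolevNorm 2 (u t' - u t)) (𝓝[Ioc 0 T] t) (𝓝 0)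
  differentiableAt : ∀ t ∈ Ioo 0 T, DifferentiableAt ℝ u t
  integrable : ∀ t ∈ Ioo 0 T,
    IntervalIntegrable (fun s => ((t - s) ^ (-γ) : ℝ) • deriv u s) volume 0 t
  equation : ∀ t ∈ Ioo 0 T,
    ((caputoDeriv γ u t : L2 n) : 𝓢'(Rn n, ℂ)) = Δ ((u t : L2 n) : 𝓢'(Rn n, ℂ))
  final : u T = g

/-- The Fourier transform `φ̂(ξ) = (2π)^{-n/2} exp(-τ |ξ|^s)` of the mollifier kernel `φ`. -/
def kernelHat {n : ℕ} (τ s : ℝ) (ξ : Rn n) : ℝ :=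
  ((√(2 * Real.pi)) ^ n)⁻¹ * Real.exp (-τ * ‖ξ‖ ^ s)

/-- `ψ` is a positive function on `[0,∞) × (0,T]` that approximates
`(r,t) ↦ E_{γ,1}(-r² t^γ)` with relative error at most `h` in `L^∞(ℝⁿ)`, for each `t`. -/
structure IsApproxSymbol (n : ℕ) (γ T h : ℝ) (ψ : ℝ → ℝ → ℝ) : Prop where
  pos : ∀ r, 0 ≤ r → ∀ t ∈ Ioc 0 T, 0 < ψ r t
  aestronglyMeasurable : ∀ t ∈ Ioc 0 T,
    AEStronglyMeasurable (fun ξ : Rn n => ψ ‖ξ‖ t) volume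
  error_le : ∀ t ∈ Ioc 0 T,
    eLpNorm (fun ξ : Rn n =>
      (ψ ‖ξ‖ t - mittagLeffler γ (-‖ξ‖ ^ 2 * t ^ γ)) / mittagLeffler γ (-‖ξ‖ ^ 2 * t ^ γ))
      ∞ volume ≤ ENNReal.ofReal h

/-- `v` is the initial value `u_α^{δ,h}(·,0)` of the regularized solution, the element of
`L²(ℝⁿ)` with Fourier transform `(2π)^{n/2} φ̂(αξ) ĝ^δ(ξ) / ψ_h(|ξ|,T)`. -/
def IsRegularizedInitial {n : ℕ} (τ s T α : ℝ) (ψ : ℝ → ℝ → ℝ) (gδ v : L2 n) : Prop :=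
  ∀ᵐ ξ : Rn n ∂volume, fourierHat v ξ =
    (((√(2 * Real.pi)) ^ n * kernelHat τ s (α • ξ) : ℝ) : ℂ) *
      (fourierHat gδ ξ / ((ψ ‖ξ‖ T : ℝ) : ℂ))

end FracDiffusion

end

/-! ### Beta integrals and the Mittag-Leffler series -/

namespace FracDiffusion

/-! On the Fourier side the problem is multiplication by a symbol: `ĝ = e û₀` with `e(ξ) = E_γ(-|ξ|²
T^γ)` (`ae_fourierHat_final_eq`). Inversion is ill-posed only by two derivatives, because `E_γ(-x) ≥
1 / (1 + Γ(1-γ) x)` gives `1/e ≲ 1 + |ξ|²` (`inv_le_mittagLeffler_neg`).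

With `κ = exp(-τ (α|ξ|)^s)` and `d = ĝ - ĝ^δ`, the error splits as `û₀ - κ ĝ^δ/ψ = (1-κ) û₀ + κ
((ψ-e)/ψ) û₀ + (κ/ψ) d`. In `H^l` the three terms are bounded by multiples of `α^(p-l) E`, `h E` and
`α^(-(l+2)) δ`. The choice `α^(p+2) = h + δ/E` balances the first and the last, and the middle one
is absorbed because `h + δ/E ≤ 1 + M`. If `α = 0` the data are exact and the last term is absent.

The identity for `ĝ` cannot be read off from an ordinary equation at fixed `ξ`, since `u` is only a
curve in `L²`. Instead `𝓕 (u t)` is paired with `φ m^k`, where `φ` is a test function and `m` is the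
symbol of `-Δ`. The moments `a_k` satisfy `∂^γ a_k = -a_{k+1}` and `|a_k| ≤ K R^k`. Inverting the
Caputo derivative and iterating expresses `a_0(T)` as a Mittag-Leffler series in the `a_k(0)`, which
sums to the pairing of `e û₀` with `φ`.

The lower bound on `E_γ` is a comparison argument at a negative minimum; it needs neither complete
monotonicity nor contour integrals. -/

theorem integral_sub_rpow_mul_rpow {a b t : ℝ} (ha : 0 < a) (hb : 0 < b) (ht : 0 < t) :
    ∫ s in (0 : ℝ)..t, (t - s) ^ (a - 1) * s ^ (b - 1) =
      t ^ (a + b - 1) * (Real.Gamma a * Real.Gamma b / Real.Gamma (a + b)) := by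
  have h1 := Complex.betaIntegral_scaled (b : ℂ) (a : ℂ) ht
  have h2 := Complex.Gamma_mul_Gamma_eq_betaIntegral (s := (b : ℂ)) (t := (a : ℂ))
    (by simpa using hb) (by simpa using ha)
  have hG : (Real.Gamma (a + b) : ℂ) ≠ 0 := by
    exact_mod_cast (Real.Gamma_pos_of_pos (add_pos ha hb)).ne'
  have h3 : Complex.betaIntegral b a
      = ((Real.Gamma a * Real.Gamma b / Real.Gamma (a + b) : ℝ) : ℂ) := by
    rw [← Complex.ofReal_add, Complex.Gamma_ofReal, Complex.Gamma_ofReal, Complex.Gamma_ofReal,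
      add_comm b a] at h2
    push_cast
    rw [eq_div_iff hG, mul_comm (Real.Gamma a : ℂ), h2]
    ring
  rw [h3] at h1
  apply Complex.ofReal_injective
  rw [← intervalIntegral.integral_ofReal]
  push_cast
  push_cast at h1
  rw [Complex.ofReal_cpow ht.le]
  push_cast
  rw [add_comm (a : ℂ) b, ← h1]
  refine intervalIntegral.integral_congr fun s hs => ?_
  rw [uIcc_of_le ht.le] at hs
  rw [Complex.ofReal_cpow hs.1, Complex.ofReal_cpow (sub_nonneg.2 hs.2)]
  push_cast
  ring

theorem intervalIntegrable_sub_rpow_mul_rpow {a b t : ℝ} (ha : 0 < a) (hb : 0 < b) (ht : 0 < t) :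
    IntervalIntegrable (fun s => (t - s) ^ (a - 1) * s ^ (b - 1)) volume 0 t := by
  -- A function that is not integrable has integral `0` by convention, so the positive value just
  -- computed proves integrability.
  apply intervalIntegral.intervalIntegrable_of_integral_ne_zero
  rw [integral_sub_rpow_mul_rpow ha hb ht]
  have := Real.Gamma_pos_of_pos ha
  have := Real.Gamma_pos_of_pos hb
  have := Real.Gamma_pos_of_pos (add_pos ha hb)
  positivity

/-- Keep only the part `t > R` of the Gamma integral, where `t^x ≥ R^x`. Since `R` is free, this
shows that `Γ(γk+1)` outgrows every geometric sequence. -/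
theorem exp_neg_mul_rpow_le_Gamma {R x : ℝ} (hR : 0 < R) (hx : 0 ≤ x) :
    Real.exp (-R) * R ^ x ≤ Real.Gamma (x + 1) := by
  rw [Real.Gamma_eq_integral (by linarith), ← integral_exp_neg_Ioi, ← integral_mul_const]
  have hInt := Real.GammaIntegral_convergent (s := x + 1) (by linarith)
  refine (setIntegral_mono_on (g := fun t => Real.exp (-t) * t ^ (x + 1 - 1)) ?_
    (hInt.mono_set (Ioi_subset_Ioi hR.le)) measurableSet_Ioi ?_).trans
    (setIntegral_mono_set hInt ?_ (Ioi_subset_Ioi hR.le).eventuallyLE)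
  · exact (integrableOn_exp_neg_Ioi R).mul_const _
  · intro t ht
    rw [add_sub_cancel_right]
    gcongr
    exact ht.le
  · filter_upwards [ae_restrict_mem measurableSet_Ioi] with t ht
    have : (0 : ℝ) < t := ht
    simp only [Pi.zero_apply]
    positivity

theorem Gamma_mul_add_one_pos {γ : ℝ} (hγ : 0 < γ) (k : ℕ) : 0 < Real.Gamma (γ * k + 1) :=
  Real.Gamma_pos_of_pos (by positivity)

/-- The coefficients of the Mittag-Leffler series decay faster than every geometric sequence. -/
theorem exists_inv_Gamma_le {γ : ℝ} (hγ : 0 < γ) {r : ℝ} (hr : 0 < r) :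
    ∃ K : ℝ, 0 < K ∧ ∀ k : ℕ, r ^ k / Real.Gamma (γ * k + 1) ≤ K * (1 / 4) ^ k := by
  -- Chosen so that `R^(γk) = (4r)^k`. The ratio `1/4` leaves `1/2` after the factor `k ≤ 2^k` of
  -- the differentiated series.
  set R : ℝ := (4 * r) ^ (1 / γ) with hR
  have hR0 : 0 < R := by positivity
  refine ⟨Real.exp R, Real.exp_pos _, fun k => ?_⟩
  rw [div_le_iff₀ (Gamma_mul_add_one_pos hγ k)]
  have h := exp_neg_mul_rpow_le_Gamma hR0 (show 0 ≤ γ * k by positivity)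
  have h2 : R ^ (γ * k) = (4 * r) ^ k := by
    rw [hR, ← Real.rpow_mul (by positivity), ← Real.rpow_natCast]
    congr 1
    field_simp
  rw [h2, mul_pow] at h
  calc r ^ k = Real.exp R * (1 / 4) ^ k * (Real.exp (-R) * (4 ^ k * r ^ k)) := by
        have h4 : ((1 : ℝ) / 4) ^ k * 4 ^ k = 1 := by rw [← mul_pow]; norm_num
        have h5 : Real.exp R * Real.exp (-R) = 1 := by rw [← Real.exp_add]; simp
        linear_combination (-r ^ k * (Real.exp R * Real.exp (-R))) * h4 - r ^ k * h5
    _ ≤ _ := by gcongr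

theorem summable_mittagLeffler {γ : ℝ} (hγ : 0 < γ) (x : ℝ) :
    Summable fun k : ℕ => x ^ k / Real.Gamma (γ * k + 1) := by
  obtain ⟨K, hK, h⟩ := exists_inv_Gamma_le hγ (r := |x| + 1) (by positivity)
  refine Summable.of_norm_bounded ((summable_geometric_of_lt_one (r := (1 : ℝ) / 4) (by norm_num)
    (by norm_num)).mul_left K) fun k => (le_trans ?_ (h k))
  have := Gamma_mul_add_one_pos hγ k
  rw [norm_div, norm_pow, Real.norm_eq_abs, Real.norm_of_nonneg this.le]
  gcongr
  linarith

/-- A summable bound, uniform on balls, for the terms of the differentiated series. -/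
theorem exists_norm_deriv_mittagLeffler_term_le {γ : ℝ} (hγ : 0 < γ) {r : ℝ} (hr : 1 ≤ r) :
    ∃ K : ℝ, ∀ (k : ℕ) (y : ℝ), y ∈ Metric.ball (0 : ℝ) r →
      ‖k * y ^ (k - 1) / Real.Gamma (γ * k + 1)‖ ≤ K * (1 / 2) ^ k := by
  obtain ⟨K, hK, h⟩ := exists_inv_Gamma_le hγ (r := r) (by positivity)
  refine ⟨K, fun k y hy => ?_⟩
  have hy' : |y| ≤ r := by simpa using (mem_ball_zero_iff.1 hy).le
  have hG := Gamma_mul_add_one_pos hγ k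
  rcases k with _ | k
  · simp [hK.le]
  have h2 : ((k + 1 : ℕ) : ℝ) ≤ 2 ^ (k + 1) := by exact_mod_cast Nat.lt_two_pow_self.le
  have h3 : |y| ^ k ≤ r ^ (k + 1) := by
    calc |y| ^ k ≤ r ^ k := by gcongr
      _ ≤ _ := pow_le_pow_right₀ hr (Nat.le_succ k)
  rw [norm_div, norm_mul, norm_pow, Real.norm_eq_abs, Real.norm_eq_abs, Real.norm_of_nonneg hG.le,
    Nat.abs_cast, Nat.add_sub_cancel]
  calc ((k + 1 : ℕ) : ℝ) * |y| ^ k / Real.Gamma (γ * (k + 1 : ℕ) + 1)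
      ≤ 2 ^ (k + 1) * r ^ (k + 1) / Real.Gamma (γ * (k + 1 : ℕ) + 1) := by gcongr
    _ = 2 ^ (k + 1) * (r ^ (k + 1) / Real.Gamma (γ * (k + 1 : ℕ) + 1)) := by ring
    _ ≤ 2 ^ (k + 1) * (K * (1 / 4) ^ (k + 1)) := by gcongr; exact h (k + 1)
    _ = K * (1 / 2) ^ (k + 1) := by
      rw [mul_left_comm, ← mul_pow]; norm_num

/-- The derivative of the Mittag-Leffler function. -/
noncomputable def mittagLefflerDeriv (γ x : ℝ) : ℝ :=
  ∑' k : ℕ, k * x ^ (k - 1) / Real.Gamma (γ * k + 1)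

theorem summable_geometric_half (K : ℝ) : Summable fun k : ℕ => K * (1 / 2 : ℝ) ^ k :=
  (summable_geometric_of_lt_one (by norm_num) (by norm_num)).mul_left K

theorem summable_mittagLefflerDeriv {γ : ℝ} (hγ : 0 < γ) (x : ℝ) :
    Summable fun k : ℕ => k * x ^ (k - 1) / Real.Gamma (γ * k + 1) := by
  obtain ⟨K, h⟩ := exists_norm_deriv_mittagLeffler_term_le hγ (r := |x| + 1)
    (by linarith [abs_nonneg x])
  exact Summable.of_norm_bounded (summable_geometric_half K) fun k => h k x (by simp)

theorem hasDerivAt_mittagLeffler {γ : ℝ} (hγ : 0 < γ) (x : ℝ) :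
    HasDerivAt (mittagLeffler γ) (mittagLefflerDeriv γ x) x := by
  obtain ⟨K, h⟩ := exists_norm_deriv_mittagLeffler_term_le hγ (r := |x| + 1)
    (by linarith [abs_nonneg x])
  have hx : x ∈ Metric.ball (0 : ℝ) (|x| + 1) := by simp
  exact hasDerivAt_tsum_of_isPreconnected (summable_geometric_half K) Metric.isOpen_ball
    (convex_ball (0 : ℝ) (|x| + 1)).isPreconnected
    (g := fun (k : ℕ) y => y ^ k / Real.Gamma (γ * k + 1))
    (fun k y _ => (hasDerivAt_pow k y).div_const _) h hx (summable_mittagLeffler hγ x) hx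

theorem continuous_mittagLefflerDeriv {γ : ℝ} (hγ : 0 < γ) :
    Continuous (mittagLefflerDeriv γ) := by
  refine continuous_iff_continuousAt.2 fun x => ?_
  obtain ⟨K, h⟩ := exists_norm_deriv_mittagLeffler_term_le hγ (r := |x| + 1)
    (by linarith [abs_nonneg x])
  refine (continuousOn_tsum (fun k => ?_) (summable_geometric_half K) h).continuousAt
    (Metric.isOpen_ball.mem_nhds (by simp))
  fun_prop

theorem continuous_mittagLeffler {γ : ℝ} (hγ : 0 < γ) : Continuous (mittagLeffler γ) :=
  continuous_iff_continuousAt.2 fun x => (hasDerivAt_mittagLeffler hγ x).continuousAt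

theorem mittagLeffler_zero (γ : ℝ) : mittagLeffler γ 0 = 1 := by
  rw [mittagLeffler, tsum_eq_single 0]
  · simp
  · intro k hk
    simp [hk]

end FracDiffusion

/-! ### The relaxation equation and a lower bound for the Mittag-Leffler function -/

namespace FracDiffusion

theorem hasDerivAt_mittagLeffler_neg_rpow {γ : ℝ} (hγ : 0 < γ) {s : ℝ} (hs : 0 < s) :
    HasDerivAt (fun s : ℝ => mittagLeffler γ (-s ^ γ))
      (mittagLefflerDeriv γ (-s ^ γ) * (-(γ * s ^ (γ - 1)))) s :=
  (hasDerivAt_mittagLeffler hγ _).comp s (Real.hasDerivAt_rpow_const (Or.inl hs.ne')).neg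

theorem intervalIntegrable_caputo_mittagLeffler {γ : ℝ} (hγ : γ ∈ Ioo (0 : ℝ) 1) {t : ℝ}
    (ht : 0 < t) : IntervalIntegrable (fun s : ℝ => (t - s) ^ (-γ) *
      (mittagLefflerDeriv γ (-s ^ γ) * (-(γ * s ^ (γ - 1))))) volume 0 t := by
  have h := (intervalIntegrable_sub_rpow_mul_rpow (a := 1 - γ) (b := γ) (by linarith [hγ.2])
    hγ.1 ht).mul_continuousOn (g := fun s : ℝ => -γ * mittagLefflerDeriv γ (-s ^ γ)) (by
      refine Continuous.continuousOn ?_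
      exact continuous_const.mul ((continuous_mittagLefflerDeriv hγ.1).comp
        (Real.continuous_rpow_const hγ.1.le).neg))
  refine h.congr fun s _ => ?_
  simp only [sub_sub_cancel_left]
  ring

/-- This is the relaxation equation `∂^γ y = -y` for `y(t) = E_γ(-t^γ)`, without the Caputo
normalization. Each term is a Beta integral that lowers the power by `γ`, which shifts the series by
one index. Sum and integral commute because the `L¹` norms of the terms form the same series without
signs. -/
theorem integral_caputo_mittagLeffler {γ : ℝ} (hγ : γ ∈ Ioo (0 : ℝ) 1) {t : ℝ} (ht : 0 < t) :
    ∫ s in (0 : ℝ)..t, (t - s) ^ (-γ) * (mittagLefflerDeriv γ (-s ^ γ) * (-(γ * s ^ (γ - 1)))) =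
      -(Real.Gamma (1 - γ) * mittagLeffler γ (-t ^ γ)) := by
  have hγ0 := hγ.1
  have h1γ : 0 < 1 - γ := by linarith [hγ.2]
  have hΓ := Real.Gamma_pos_of_pos h1γ
  set F : ℕ → ℝ → ℝ := fun k s =>
    (-1) ^ (k + 1) / Real.Gamma (γ * (k + 1)) * ((t - s) ^ ((1 - γ) - 1) * s ^ (γ * (k + 1) - 1))
    with hF
  have hpos : ∀ k : ℕ, 0 < γ * ((k : ℝ) + 1) := fun k => by positivity
  have hsum : ∀ s ∈ Ioc 0 t, ∑' k, F k s =
      (t - s) ^ (-γ) * (mittagLefflerDeriv γ (-s ^ γ) * (-(γ * s ^ (γ - 1)))) := by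
    intro s hs
    rw [mittagLefflerDeriv, (summable_mittagLefflerDeriv hγ0 _).tsum_eq_zero_add]
    simp only [Nat.cast_zero, zero_mul, zero_div, zero_add]
    rw [← tsum_mul_right, ← tsum_mul_left]
    refine tsum_congr fun k => ?_
    have e1 : (-s ^ γ) ^ k = (-1) ^ k * s ^ (γ * k) := by
      rw [neg_pow, ← Real.rpow_natCast (s ^ γ), ← Real.rpow_mul hs.1.le]
    have e2 : s ^ (γ * ((k : ℝ) + 1) - 1) = s ^ (γ * k) * s ^ (γ - 1) := by
      rw [← Real.rpow_add hs.1]; congr 1; ring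
    have e3 := Real.Gamma_add_one (hpos k).ne'
    have e4 := (Real.Gamma_pos_of_pos (hpos k)).ne'
    simp only [hF]
    rw [Nat.add_sub_cancel]
    push_cast
    rw [e1, e2, e3, sub_sub_cancel_left]
    field_simp
    ring
  have hInt : ∀ k, ∫ s in Ioc 0 t, F k s =
      -(Real.Gamma (1 - γ) * ((-t ^ γ) ^ k / Real.Gamma (γ * k + 1))) := by
    intro k
    rw [← intervalIntegral.integral_of_le ht.le, intervalIntegral.integral_const_mul,
      integral_sub_rpow_mul_rpow h1γ (hpos k) ht]
    have e1 : (-t ^ γ) ^ k = (-1) ^ k * t ^ (γ * k) := by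
      rw [neg_pow, ← Real.rpow_natCast (t ^ γ), ← Real.rpow_mul ht.le]
    have e4 := (Real.Gamma_pos_of_pos (hpos k)).ne'
    rw [e1, show 1 - γ + γ * ((k : ℝ) + 1) = γ * k + 1 by ring, add_sub_cancel_right]
    field_simp
    ring
  have hintble : ∀ k, Integrable (F k) (volume.restrict (Ioc 0 t)) := fun k =>
    (((intervalIntegrable_sub_rpow_mul_rpow h1γ (hpos k) ht).const_mul _).1)
  have hnorm : ∀ k, ∫ s in Ioc 0 t, ‖F k s‖ =
      Real.Gamma (1 - γ) * ((t ^ γ) ^ k / Real.Gamma (γ * k + 1)) := by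
    intro k
    have h : ∀ s ∈ Ioc 0 t, ‖F k s‖ = (-1) ^ (k + 1) * F k s := by
      intro s hs
      have e4 := (Real.Gamma_pos_of_pos (hpos k))
      have := Real.rpow_nonneg (sub_nonneg.2 hs.2) (1 - γ - 1)
      have := Real.rpow_nonneg hs.1.le (γ * ((k : ℝ) + 1) - 1)
      simp only [hF]
      rw [norm_mul, norm_div, norm_pow, norm_neg, norm_one, one_pow, Real.norm_of_nonneg e4.le,
        Real.norm_of_nonneg (mul_nonneg ‹_› ‹_›)]
      have : ((-1 : ℝ)) ^ (k + 1) * (-1) ^ (k + 1) = 1 := by rw [← mul_pow]; norm_num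
      linear_combination (-(1 / Real.Gamma (γ * (k + 1)) *
        ((t - s) ^ (1 - γ - 1) * s ^ (γ * ((k : ℝ) + 1) - 1)))) * this
    rw [setIntegral_congr_fun measurableSet_Ioc h, integral_const_mul, hInt, neg_pow (t ^ γ)]
    have : ((-1 : ℝ)) ^ (k + 1) * (-1) ^ k = -1 := by
      rw [pow_succ, mul_right_comm, ← mul_pow]; norm_num
    linear_combination (-(Real.Gamma (1 - γ) * ((t ^ γ) ^ k / Real.Gamma (γ * k + 1)))) * this
  have key := hasSum_integral_of_summable_integral_norm hintble (by
    simp_rw [hnorm]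
    exact (summable_mittagLeffler hγ0 _).mul_left _)
  rw [intervalIntegral.integral_of_le ht.le, ← setIntegral_congr_fun measurableSet_Ioc hsum,
    ← key.tsum_eq]
  simp_rw [hInt]
  rw [tsum_neg, tsum_mul_left, mittagLeffler]

/-- Lower bound for the Mittag-Leffler function, by comparison of `t ↦ E_γ(-t^γ)` with the
subsolution `t ↦ 1 / (1 + Γ(1-γ) t^γ)` at a negative minimum of the difference. -/
theorem inv_le_mittagLeffler_neg_rpow {γ : ℝ} (hγ : γ ∈ Ioo (0 : ℝ) 1) {t₀ : ℝ} (ht₀ : 0 ≤ t₀) :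
    (1 + Real.Gamma (1 - γ) * t₀ ^ γ)⁻¹ ≤ mittagLeffler γ (-t₀ ^ γ) := by
  have hγ0 := hγ.1
  set A := Real.Gamma (1 - γ) with hA
  have hA0 : 0 < A := Real.Gamma_pos_of_pos (by linarith [hγ.2])
  set w : ℝ → ℝ := fun s => (1 + A * s ^ γ)⁻¹ with hw
  set d : ℝ → ℝ := fun s => mittagLeffler γ (-s ^ γ) - w s with hd
  have hden : ∀ s : ℝ, 0 ≤ s → 0 < 1 + A * s ^ γ := fun s hs => by positivity
  have hwc : ContinuousOn w (Ici 0) :=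
    ContinuousOn.inv₀ (continuous_const.add (continuous_const.mul
      (Real.continuous_rpow_const hγ0.le))).continuousOn fun s hs => (hden s hs).ne'
  have hyc : Continuous fun s : ℝ => mittagLeffler γ (-s ^ γ) :=
    (continuous_mittagLeffler hγ0).comp (Real.continuous_rpow_const hγ0.le).neg
  have hdc : ContinuousOn d (Ici 0) := hyc.continuousOn.sub hwc
  have hw' : ∀ s : ℝ, 0 < s → HasDerivAt w (-(A * (γ * s ^ (γ - 1))) / (1 + A * s ^ γ) ^ 2) s :=
    fun s hs => (((Real.hasDerivAt_rpow_const (Or.inl hs.ne')).const_mul A).const_add 1).inv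
      (hden s hs.le).ne'
  by_contra! hcon
  obtain ⟨t, ht, hmin⟩ := isCompact_Icc.exists_isMinOn (nonempty_Icc.2 ht₀)
    (hdc.mono Icc_subset_Ici_self)
  have hdt : d t < 0 := by
    refine lt_of_le_of_lt (hmin (right_mem_Icc.2 ht₀)) ?_
    simpa [hd, hw] using hcon
  have hd0 : d 0 = 0 := by
    simp [hd, hw, Real.zero_rpow hγ0.ne', mittagLeffler_zero]
  have ht0 : 0 < t := by
    rcases ht.1.eq_or_lt with h | h
    · rw [← h, hd0] at hdt
      exact absurd hdt (lt_irrefl _)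
    · exact h
  have hge : ∀ s ∈ Icc 0 t, d t ≤ d s := fun s hs => hmin ⟨hs.1, hs.2.trans ht.2⟩
  have hd' : ∀ s : ℝ, 0 < s → HasDerivAt d (mittagLefflerDeriv γ (-s ^ γ) * (-(γ * s ^ (γ - 1))) -
      -(A * (γ * s ^ (γ - 1))) / (1 + A * s ^ γ) ^ 2) s :=
    fun s hs => (hasDerivAt_mittagLeffler_neg_rpow hγ0 hs).sub (hw' s hs)
  -- With `y = d + w`, `G' - (t-s)^(-γ) y'` equals `γ (t-s)^(-γ-1) (d s - d t) + (t^(-γ) -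
  -- (t-s)^(-γ)) w'`. Both summands are nonnegative: `d` is minimal at `t`, and `w` decreases. Hence
  -- `∫ (t-s)^(-γ) y' ≤ G t - G 0`.
  set G : ℝ → ℝ := fun s => (t - s) ^ (-γ) * (d s - d t) + t ^ (-γ) * w s with hG
  have hsub : ∀ s, HasDerivAt (fun s : ℝ => t - s) (-1) s := fun s => by
    simpa using (hasDerivAt_id s).const_sub t
  have hcontG : ContinuousOn G (Icc 0 t) := by
    refine ContinuousOn.add ?_ (continuousOn_const.mul (hwc.mono Icc_subset_Ici_self))
    intro s hs
    rcases hs.2.eq_or_lt with h | h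
    · subst h
      -- At the endpoint, differentiability of `d` gives a linear bound on the increment, and this
      -- beats the singularity of order `γ < 1`.
      have hO : (fun x => d x - d s) =O[𝓝 s] fun x => x - s := (hd' s ht0).isBigO_sub
      obtain ⟨c, hc⟩ := hO.bound
      have hz : (s - s) ^ (-γ) * (d s - d s) = 0 := by simp
      rw [ContinuousWithinAt, hz]
      have hlim : Tendsto (fun x : ℝ => c * |s - x| ^ (1 - γ)) (𝓝[Icc 0 s] s) (𝓝 0) := by
        have : Continuous fun x : ℝ => c * |s - x| ^ (1 - γ) :=
          continuous_const.mul ((Real.continuous_rpow_const (by linarith [hγ.2])).comp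
            (continuous_const.sub continuous_id).abs)
        have h2 := this.tendsto s
        simp only [sub_self, abs_zero, Real.zero_rpow (show (1 - γ) ≠ 0 by linarith [hγ.2]),
          mul_zero] at h2
        exact h2.mono_left nhdsWithin_le_nhds
      refine squeeze_zero_norm' ?_ hlim
      filter_upwards [nhdsWithin_le_nhds hc, self_mem_nhdsWithin] with x hx hxs
      rcases hxs.2.eq_or_lt with h' | h'
      · have h0 : (1 - γ) ≠ 0 := by linarith [hγ.2]
        simp [h', Real.zero_rpow h0]
      · have hp : 0 < s - x := sub_pos.2 h'
        rw [norm_mul, Real.norm_of_nonneg (Real.rpow_nonneg hp.le _), abs_of_pos hp]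
        calc (s - x) ^ (-γ) * ‖d x - d s‖ ≤ (s - x) ^ (-γ) * (c * ‖x - s‖) := by gcongr
          _ = c * (s - x) ^ (1 - γ) := by
            rw [norm_sub_rev, Real.norm_of_nonneg hp.le, sub_eq_add_neg 1 γ, Real.rpow_add hp,
              Real.rpow_one]
            ring
    · refine ContinuousWithinAt.mul ?_ (((hdc.mono Icc_subset_Ici_self) s hs).sub
        continuousWithinAt_const)
      exact ((hsub s).continuousAt.rpow_const (Or.inl (sub_pos.2 h).ne')).continuousWithinAt
  have hGd : ∀ s ∈ Ioo 0 t, HasDerivWithinAt G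
      (((-1) * -γ * (t - s) ^ (-γ - 1)) * (d s - d t) + (t - s) ^ (-γ) *
        (mittagLefflerDeriv γ (-s ^ γ) * (-(γ * s ^ (γ - 1))) -
          -(A * (γ * s ^ (γ - 1))) / (1 + A * s ^ γ) ^ 2) +
        t ^ (-γ) * (-(A * (γ * s ^ (γ - 1))) / (1 + A * s ^ γ) ^ 2)) (Ioi s) s := by
    intro s hs
    exact ((((hsub s).rpow_const (Or.inl (sub_pos.2 hs.2).ne')).mul ((hd' s hs.1).sub_const _)).add
      ((hw' s hs.1).const_mul _)).hasDerivWithinAt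
  have hle := intervalIntegral.integral_le_sub_of_hasDeriv_right_of_le ht0.le hcontG hGd
    ((intervalIntegrable_iff_integrableOn_Icc_of_le ht0.le).1
      (intervalIntegrable_caputo_mittagLeffler hγ ht0)) (by
    intro s hs
    have h1 : 0 < t - s := sub_pos.2 hs.2
    have h2 : 0 ≤ d s - d t := sub_nonneg.2 (hge s ⟨hs.1.le, hs.2.le⟩)
    have h3 : 0 ≤ A * (γ * s ^ (γ - 1)) / (1 + A * s ^ γ) ^ 2 := by
      have := hs.1
      positivity
    have h4 : t ^ (-γ) ≤ (t - s) ^ (-γ) :=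
      Real.rpow_le_rpow_of_nonpos h1 (by linarith [hs.1]) (by linarith)
    have h5 : 0 ≤ γ * (t - s) ^ (-γ - 1) * (d s - d t) := by positivity
    have h6 := mul_nonneg (sub_nonneg.2 h4) h3
    rw [neg_div]
    nlinarith [h5, h6])
  -- The left side is now `-A y(t)`. Since `t^(-γ) (w t - 1) = -A w t`, the inequality becomes `0 ≤
  -- d t * (A + t^(-γ))`, contradicting `d t < 0`.
  rw [integral_caputo_mittagLeffler hγ ht0] at hle
  have hw0 : w 0 = 1 := by simp [hw, Real.zero_rpow hγ0.ne']
  have hGt : G t = t ^ (-γ) * w t := by simp [hG]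
  have hG0 : G 0 = t ^ (-γ) * (0 - d t) + t ^ (-γ) := by simp [hG, hd0, hw0]
  rw [hGt, hG0] at hle
  have hwt : w t * (1 + A * t ^ γ) = 1 := inv_mul_cancel₀ (hden t ht0.le).ne'
  have hy : mittagLeffler γ (-t ^ γ) = d t + w t := by simp [hd]
  have htt : t ^ (-γ) * t ^ γ = 1 := by rw [← Real.rpow_add ht0]; simp
  have htp : 0 < t ^ (-γ) := by positivity
  rw [hy] at hle
  have : 0 ≤ d t * (A + t ^ (-γ)) := by
    have : t ^ (-γ) * w t - t ^ (-γ) = -(A * w t) := by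
      linear_combination t ^ (-γ) * hwt - A * w t * htt
    nlinarith
  nlinarith [mul_pos (neg_pos.2 hdt) (add_pos hA0 htp)]

theorem inv_le_mittagLeffler_neg {γ : ℝ} (hγ : γ ∈ Ioo (0 : ℝ) 1) {x : ℝ} (hx : 0 ≤ x) :
    (1 + Real.Gamma (1 - γ) * x)⁻¹ ≤ mittagLeffler γ (-x) := by
  have h := inv_le_mittagLeffler_neg_rpow hγ (t₀ := x ^ (1 / γ)) (by positivity)
  rwa [← Real.rpow_mul hx, one_div_mul_cancel hγ.1.ne', Real.rpow_one] at h

end FracDiffusion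

/-! ### Inversion of the Caputo derivative and Volterra hierarchies -/

namespace FracDiffusion

/-- The exponents of the Abel kernels add up to `-1`, so the value does not depend on `r` and `t`.
This is why the composed fractional integrals reduce to an ordinary one. -/
theorem integral_sub_rpow_mul_sub_rpow {γ : ℝ} (hγ : γ ∈ Ioo (0 : ℝ) 1) {r t : ℝ} (hrt : r < t) :
    ∫ s in r..t, (t - s) ^ (γ - 1) * (s - r) ^ (-γ) = Real.Gamma γ * Real.Gamma (1 - γ) := by
  have h := integral_sub_rpow_mul_rpow hγ.1 (b := 1 - γ) (by linarith [hγ.2]) (sub_pos.2 hrt)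
  have h2 := intervalIntegral.integral_comp_sub_right (a := r) (b := t)
    (fun x => (t - r - x) ^ (γ - 1) * x ^ (1 - γ - 1)) r
  rw [sub_self, h] at h2
  simp only [sub_sub_sub_cancel_right, sub_sub_cancel_left] at h2
  rw [h2]
  simp

variable {E : Type*} [NormedAddCommGroup E] [NormedSpace ℝ E]

theorem intervalIntegrable_of_sub_rpow_smul {γ t : ℝ} (hγ : 0 < γ) (ht : 0 < t) {f : ℝ → E}
    (h : IntervalIntegrable (fun s => (t - s) ^ (-γ) • f s) volume 0 t) :
    IntervalIntegrable f volume 0 t := by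
  have h2 := h.continuousOn_smul (f := fun s : ℝ => (t - s) ^ γ)
    ((Real.continuous_rpow_const hγ.le).comp (continuous_const.sub continuous_id)).continuousOn
  rw [intervalIntegrable_iff_integrableOn_Ioo_of_le ht.le] at h2 ⊢
  refine h2.congr_fun (fun s hs => ?_) measurableSet_Ioo
  have : 0 < t - s := sub_pos.2 hs.2
  simp only [smul_smul]
  rw [← Real.rpow_add this, add_neg_cancel, Real.rpow_zero, one_smul]

/-- The Riemann-Liouville integral of order `γ` inverts the Caputo derivative of order `γ`. -/
theorem integral_sub_rpow_smul_caputo [CompleteSpace E] {γ t : ℝ} (hγ : γ ∈ Ioo (0 : ℝ) 1) (ht : 0 < t)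
    {a a' : ℝ → E} (hc : ContinuousOn a (Icc 0 t)) (hd : ∀ s ∈ Ioo 0 t, HasDerivAt a (a' s) s)
    (hi : IntervalIntegrable (fun s => (t - s) ^ (-γ) • a' s) volume 0 t) :
    ∫ s in (0 : ℝ)..t, (t - s) ^ (γ - 1) • ∫ r in (0 : ℝ)..s, (s - r) ^ (-γ) • a' r =
      (Real.Gamma γ * Real.Gamma (1 - γ)) • (a t - a 0) := by
  set B := Real.Gamma γ * Real.Gamma (1 - γ) with hB
  have hB0 : B ≠ 0 := (mul_pos (Real.Gamma_pos_of_pos hγ.1)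
    (Real.Gamma_pos_of_pos (by linarith [hγ.2]))).ne'
  have ha' := intervalIntegrable_of_sub_rpow_smul hγ.1 ht hi
  have hftc := intervalIntegral.integral_eq_sub_of_hasDerivAt_of_le ht.le hc hd ha'
  set μ : Measure ℝ := volume.restrict (Ioo 0 t) with hμ
  have ha'μ : Integrable a' μ := (intervalIntegrable_iff_integrableOn_Ioo_of_le ht.le).1 ha'
  -- The composed kernel, cut off to the triangle `r ≤ s` so that Fubini applies on a square. Its
  -- integral over `s` is the constant `B`, which leaves `B ∫ a'`.
  set k : ℝ → ℝ → ℝ := fun s r => (Iic s).indicator (fun r => (t - s) ^ (γ - 1) * (s - r) ^ (-γ)) r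
    with hk
  have hk_eq : ∀ s r, k s r = (Ici r).indicator (fun s => (t - s) ^ (γ - 1) * (s - r) ^ (-γ)) s :=
    fun s r => by simp only [hk, indicator, mem_Iic, mem_Ici]
  have hk_nonneg : ∀ r, ∀ s ∈ Ioo 0 t, 0 ≤ k s r := by
    intro r s hs
    simp only [hk]
    refine indicator_nonneg (fun r hr => ?_) r
    exact mul_nonneg (Real.rpow_nonneg (sub_nonneg.2 hs.2.le) _)
      (Real.rpow_nonneg (sub_nonneg.2 hr) _)
  have hset : ∀ r ∈ Ioo 0 t, Ioo 0 t ∩ Ici r = Ico r t := by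
    intro r hr
    ext s
    simp only [mem_inter_iff, mem_Ioo, mem_Ici, mem_Ico]
    exact ⟨fun h => ⟨h.2, h.1.2⟩, fun h => ⟨⟨hr.1.trans_le h.1, h.2⟩, h.1⟩⟩
  have hk_int : ∀ r ∈ Ioo 0 t, ∫ s, k s r ∂μ = B := by
    intro r hr
    simp_rw [hk_eq]
    rw [hμ, setIntegral_indicator measurableSet_Ici, hset r hr, integral_Ico_eq_integral_Ioo,
      ← integral_Ioc_eq_integral_Ioo, ← intervalIntegral.integral_of_le hr.2.le,
      integral_sub_rpow_mul_sub_rpow hγ hr.2]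
  have hk_meas : Measurable fun z : ℝ × ℝ => k z.1 z.2 := by
    have : (fun z : ℝ × ℝ => k z.1 z.2) = {z : ℝ × ℝ | z.2 ≤ z.1}.indicator
        (fun z => (t - z.1) ^ (γ - 1) * (z.1 - z.2) ^ (-γ)) := by
      ext z
      simp only [hk, indicator, mem_Iic, mem_ofPred_eq]
    rw [this]
    refine Measurable.indicator ?_ (measurableSet_le measurable_snd measurable_fst)
    fun_prop
  have hprod : Integrable (Function.uncurry fun s r => k s r • a' r) (μ.prod μ) := by
    refine (integrable_prod_iff' ?_).2 ⟨?_, ?_⟩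
    · exact hk_meas.aestronglyMeasurable.smul ha'μ.aestronglyMeasurable.comp_snd
    · filter_upwards [ae_restrict_mem measurableSet_Ioo] with r hr
      have : Integrable (fun s => k s r) μ := by
        by_contra hcon
        exact hB0 ((hk_int r hr).symm.trans (integral_undef hcon))
      exact this.smul_const (a' r)
    · refine (ha'μ.norm.const_mul B).congr ?_
      filter_upwards [ae_restrict_mem measurableSet_Ioo] with r hr
      simp only [Function.uncurry, norm_smul]
      rw [integral_mul_const, ← hk_int r hr]
      congr 1
      refine setIntegral_congr_fun measurableSet_Ioo fun s hs => ?_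
      exact (Real.norm_of_nonneg (hk_nonneg r s hs)).symm
  have hswap := integral_integral_swap hprod
  have hleft : ∫ s, ∫ r, k s r • a' r ∂μ ∂μ =
      ∫ s in (0 : ℝ)..t, (t - s) ^ (γ - 1) • ∫ r in (0 : ℝ)..s, (s - r) ^ (-γ) • a' r := by
    rw [intervalIntegral.integral_of_le ht.le, integral_Ioc_eq_integral_Ioo]
    refine setIntegral_congr_fun measurableSet_Ioo fun s hs => ?_
    have hset' : Ioo 0 t ∩ Iic s = Ioc 0 s := by
      ext r
      simp only [mem_inter_iff, mem_Ioo, mem_Iic, mem_Ioc]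
      exact ⟨fun h => ⟨h.1.1, h.2⟩, fun h => ⟨⟨h.1, h.2.trans_lt hs.2⟩, h.2⟩⟩
    have : ∀ r, k s r • a' r =
        (Iic s).indicator (fun r => (t - s) ^ (γ - 1) • (s - r) ^ (-γ) • a' r) r := by
      intro r
      simp only [hk, indicator, smul_smul]
      split_ifs <;> simp
    simp_rw [this]
    rw [hμ, setIntegral_indicator measurableSet_Iic, hset', integral_smul,
      intervalIntegral.integral_of_le hs.1.le]
  have hright : ∫ r, ∫ s, k s r • a' r ∂μ ∂μ = B • (a t - a 0) := by
    rw [← hftc, intervalIntegral.integral_of_le ht.le, integral_Ioc_eq_integral_Ioo, ← integral_smul]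
    refine setIntegral_congr_fun measurableSet_Ioo fun r hr => ?_
    rw [integral_smul_const, hk_int r hr]
  rw [← hleft, hswap, hright]

theorem integral_sub_rpow_mul_rpow_mul {γ : ℝ} (hγ : 0 < γ) {t : ℝ} (ht : 0 < t) (k : ℕ) :
    ∫ s in (0 : ℝ)..t, (t - s) ^ (γ - 1) * s ^ (γ * k) =
      Real.Gamma γ * Real.Gamma (γ * k + 1) *
        (t ^ (γ * (k + 1 : ℕ)) / Real.Gamma (γ * (k + 1 : ℕ) + 1)) := by
  have h := integral_sub_rpow_mul_rpow hγ (b := γ * k + 1) (by positivity) ht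
  simp only [add_sub_cancel_right] at h
  rw [h]
  push_cast
  rw [show γ + (γ * k + 1) - 1 = γ * (k + 1) by ring,
    show γ + (γ * k + 1) = γ * (k + 1) + 1 by ring]
  ring

theorem intervalIntegrable_sub_rpow {γ : ℝ} (hγ : 0 < γ) {t : ℝ} (ht : 0 < t) :
    IntervalIntegrable (fun s : ℝ => (t - s) ^ (γ - 1)) volume 0 t := by
  simpa using intervalIntegrable_sub_rpow_mul_rpow hγ (b := 1) one_pos ht

/-- Successive substitution in a hierarchy of Volterra equations, with a bound on the remainder. -/
theorem norm_sub_sum_le_of_volterra [CompleteSpace E] {γ T R : ℝ} (hγ : 0 < γ) (N : ℕ) :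
    ∀ (K : ℝ) (a : ℕ → ℝ → E), (∀ k, ContinuousOn (a k) (Icc 0 T)) →
      (∀ k, ∀ t ∈ Ioo 0 T, a k t = a k 0 -
        (Real.Gamma γ)⁻¹ • ∫ s in (0 : ℝ)..t, (t - s) ^ (γ - 1) • a (k + 1) s) →
      (∀ k, ∀ t ∈ Ioo 0 T, ‖a k t‖ ≤ K * R ^ k) →
      ∀ t ∈ Ioo 0 T,
        ‖a 0 t - ∑ k ∈ Finset.range N, ((-1) ^ k * t ^ (γ * k) / Real.Gamma (γ * k + 1)) • a k 0‖ ≤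
          K * R ^ N * (t ^ (γ * N) / Real.Gamma (γ * N + 1)) := by
  have hΓ := Real.Gamma_pos_of_pos hγ
  induction N with
  | zero =>
    intro K a _ _ hb t ht
    simpa using hb 0 t ht
  | succ N ih =>
    intro K a hc hv hb t ht
    -- The shifted hierarchy `a (k + 1)` satisfies the same hypotheses with `K * R`; the induction
    -- therefore quantifies over `K` and `a`.
    have ih' := ih (K * R) (fun k => a (k + 1)) (fun k => hc (k + 1)) (fun k => hv (k + 1))
      (fun k t ht => by rw [mul_assoc, ← pow_succ']; exact hb (k + 1) t ht)
    have hsub : uIcc 0 t ⊆ Icc 0 T := by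
      rw [uIcc_of_le ht.1.le]
      exact Icc_subset_Icc_right ht.2.le
    have hInt := intervalIntegrable_sub_rpow hγ ht.1
    have hInt1 : IntervalIntegrable (fun s => (t - s) ^ (γ - 1) • a 1 s) volume 0 t :=
      hInt.smul_continuousOn ((hc 1).mono hsub)
    have hpow : ∀ k : ℕ, Continuous fun s : ℝ => s ^ (γ * k) := fun k =>
      Real.continuous_rpow_const (by positivity)
    have hInt2 : ∀ k : ℕ, IntervalIntegrable (fun s => (t - s) ^ (γ - 1) •
        ((-1) ^ k * s ^ (γ * k) / Real.Gamma (γ * k + 1)) • a (k + 1) 0) volume 0 t := fun k =>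
      hInt.smul_continuousOn ((((hpow k).const_mul ((-1) ^ k)).div_const _).smul
        continuous_const).continuousOn
    have hterm : ∀ k : ℕ, ∫ s in (0 : ℝ)..t, (t - s) ^ (γ - 1) •
        ((-1) ^ k * s ^ (γ * k) / Real.Gamma (γ * k + 1)) • a (k + 1) 0 =
        -(Real.Gamma γ • ((-1) ^ (k + 1) * t ^ (γ * (k + 1 : ℕ)) /
          Real.Gamma (γ * (k + 1 : ℕ) + 1)) • a (k + 1) 0) := by
      intro k
      have hG := (Gamma_mul_add_one_pos hγ k).ne'
      have : ∀ s : ℝ, (t - s) ^ (γ - 1) •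
          ((-1) ^ k * s ^ (γ * k) / Real.Gamma (γ * k + 1)) • a (k + 1) 0 =
          ((t - s) ^ (γ - 1) * s ^ (γ * k)) • ((-1) ^ k / Real.Gamma (γ * k + 1)) • a (k + 1) 0 := by
        intro s
        rw [smul_smul, smul_smul]
        congr 1
        ring
      simp_rw [this]
      rw [intervalIntegral.integral_smul_const, integral_sub_rpow_mul_rpow_mul hγ ht.1, smul_smul,
        smul_smul, ← neg_smul]
      congr 1
      field_simp
      ring
    have hkey : a 0 t - ∑ k ∈ Finset.range (N + 1),
        ((-1) ^ k * t ^ (γ * k) / Real.Gamma (γ * k + 1)) • a k 0 =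
        -((Real.Gamma γ)⁻¹ • ∫ s in (0 : ℝ)..t, (t - s) ^ (γ - 1) • (a 1 s -
          ∑ k ∈ Finset.range N, ((-1) ^ k * s ^ (γ * k) / Real.Gamma (γ * k + 1)) • a (k + 1) 0)) := by
      have hInt3 : IntervalIntegrable (fun s => ∑ k ∈ Finset.range N, (t - s) ^ (γ - 1) •
          ((-1) ^ k * s ^ (γ * k) / Real.Gamma (γ * k + 1)) • a (k + 1) 0) volume 0 t := by
        simpa only [Finset.sum_fn] using
          IntervalIntegrable.sum (Finset.range N) fun k _ => hInt2 k
      simp_rw [smul_sub, Finset.smul_sum]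
      rw [intervalIntegral.integral_sub hInt1 hInt3,
        intervalIntegral.integral_finsetSum fun k _ => hInt2 k, Finset.sum_range_succ', hv 0 t ht]
      simp_rw [hterm]
      rw [Finset.sum_neg_distrib, ← Finset.smul_sum, smul_sub, smul_neg, smul_smul,
        inv_mul_cancel₀ hΓ.ne', one_smul]
      simp
      abel
    rw [hkey, norm_neg, norm_smul, norm_inv, Real.norm_of_nonneg hΓ.le,
      inv_mul_le_iff₀ hΓ]
    calc ‖∫ s in (0 : ℝ)..t, (t - s) ^ (γ - 1) • (a 1 s -
          ∑ k ∈ Finset.range N, ((-1) ^ k * s ^ (γ * k) / Real.Gamma (γ * k + 1)) • a (k + 1) 0)‖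
        ≤ ∫ s in (0 : ℝ)..t, (K * R * R ^ N / Real.Gamma (γ * N + 1)) *
            ((t - s) ^ (γ - 1) * s ^ (γ * N)) := by
          refine intervalIntegral.norm_integral_le_of_norm_le ht.1.le ?_ ?_
          · refine Eventually.of_forall fun s hs => ?_
            have hs' : s ∈ Ioo 0 T := ⟨hs.1, hs.2.trans_lt ht.2⟩
            have := Real.rpow_nonneg (sub_nonneg.2 hs.2) (γ - 1)
            rw [norm_smul, Real.norm_of_nonneg this]
            refine (mul_le_mul_of_nonneg_left (ih' s hs') this).trans_eq ?_
            ring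
          · exact (hInt.mul_continuousOn (hpow N).continuousOn).const_mul _
      _ = _ := by
          have hG := (Gamma_mul_add_one_pos hγ N).ne'
          rw [intervalIntegral.integral_const_mul, integral_sub_rpow_mul_rpow_mul hγ ht.1]
          rw [pow_succ]
          field_simp

/-- A bounded hierarchy of Volterra equations on `(0,T)` determines the value at `T` through a
Mittag-Leffler type series in the initial values. -/
theorem tendsto_sum_of_volterra [CompleteSpace E] {γ T R K : ℝ} (hγ : 0 < γ) (hT : 0 < T)
    {a : ℕ → ℝ → E} (hc : ∀ k, ContinuousOn (a k) (Icc 0 T))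
    (hv : ∀ k, ∀ t ∈ Ioo 0 T, a k t = a k 0 -
        (Real.Gamma γ)⁻¹ • ∫ s in (0 : ℝ)..t, (t - s) ^ (γ - 1) • a (k + 1) s)
    (hb : ∀ k, ∀ t ∈ Ioo 0 T, ‖a k t‖ ≤ K * R ^ k) :
    Tendsto (fun N => ∑ k ∈ Finset.range N,
      ((-T ^ γ) ^ k / Real.Gamma (γ * k + 1)) • a k 0) atTop (𝓝 (a 0 T)) := by
  have hpow : ∀ k : ℕ, Continuous fun s : ℝ => s ^ (γ * k) := fun k =>
      Real.continuous_rpow_const (by positivity)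
  have hTk : ∀ k : ℕ, (T ^ γ) ^ k = T ^ (γ * k) := fun k => by
    rw [← Real.rpow_natCast (T ^ γ), ← Real.rpow_mul hT.le]
  have hbound : ∀ N : ℕ, ‖(∑ k ∈ Finset.range N,
      ((-T ^ γ) ^ k / Real.Gamma (γ * k + 1)) • a k 0) - a 0 T‖ ≤
      K * ((R * T ^ γ) ^ N / Real.Gamma (γ * N + 1)) := by
    intro N
    have h := norm_sub_sum_le_of_volterra hγ N K a hc hv hb
    -- The equations hold only for `t < T`; the estimate reaches `T` by continuity.
    have hmem : T ∈ closure (Ioo 0 T) := by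
      rw [closure_Ioo hT.ne]; exact right_mem_Icc.2 hT.le
    have hle := ContinuousWithinAt.closure_le hmem
      (f := fun t => ‖a 0 t - ∑ k ∈ Finset.range N,
        ((-1) ^ k * t ^ (γ * k) / Real.Gamma (γ * k + 1)) • a k 0‖)
      (g := fun t => K * R ^ N * (t ^ (γ * N) / Real.Gamma (γ * N + 1))) ?_ ?_ h
    · rw [norm_sub_rev]
      simp_rw [neg_pow (T ^ γ), mul_pow, hTk]
      rwa [mul_div_assoc, ← mul_assoc]
    · refine ((((hc 0) T (right_mem_Icc.2 hT.le)).mono Ioo_subset_Icc_self).sub ?_).norm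
      refine (continuous_finsetSum _ fun k _ => ?_).continuousWithinAt
      exact (((hpow k).const_mul ((-1) ^ k)).div_const _).smul continuous_const
    · exact (((hpow N).div_const _).const_mul _).continuousWithinAt
  rw [tendsto_iff_norm_sub_tendsto_zero]
  refine squeeze_zero (fun _ => norm_nonneg _) hbound ?_
  simpa using ((summable_mittagLeffler hγ (R * T ^ γ)).tendsto_atTop_zero).const_mul K

end FracDiffusion

/-! ### The Fourier transform of a solution -/

namespace FracDiffusion

variable {n : ℕ}

/-- The distributional Laplacian is a Fourier multiplier. Testing against smooth compactly supported
functions turns the identity of tempered distributions into one almost everywhere. -/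
theorem ae_fourier_eq_of_eq_laplacian {f w : L2 n}
    (h : (w : 𝓢'(Rn n, ℂ)) = Δ (f : 𝓢'(Rn n, ℂ))) :
    ∀ᵐ η : Rn n, (𝓕 w : L2 n) η = -(((2 * Real.pi) ^ 2 * ‖η‖ ^ 2 : ℝ) • (𝓕 f : L2 n) η) := by
  have h1 : ((𝓕 w : L2 n) : 𝓢'(Rn n, ℂ)) = (-(2 * Real.pi) ^ 2 : ℝ) •
      TemperedDistribution.smulLeftCLM ℂ (fun x : Rn n => Complex.ofReal (‖x‖ ^ 2))
        ((𝓕 f : L2 n) : 𝓢'(Rn n, ℂ)) := by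
    rw [← Lp.fourier_toTemperedDistribution_eq, ← Lp.fourier_toTemperedDistribution_eq, h,
      TemperedDistribution.laplacian_eq_fourierMultiplierCLM,
      TemperedDistribution.fourierMultiplierCLM_apply, ← Complex.coe_smul,
      FourierTransform.fourier_smul, FourierTransform.fourier_fourierInv_eq, Complex.coe_smul]
  have hloc : ∀ g : L2 n, LocallyIntegrable (g : Rn n → ℂ) volume := fun g =>
    (Lp.memLp g).locallyIntegrable (by norm_num)
  refine ae_eq_of_integral_contDiff_smul_eq (hloc _) ?_ ?_
  · have := ((hloc (𝓕 f)).locallyIntegrableOn univ).continuousOn_smul isOpen_univ.isLocallyClosed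
      (g := fun η : Rn n => (2 * Real.pi) ^ 2 * ‖η‖ ^ 2) (by fun_prop)
    rw [locallyIntegrableOn_univ] at this
    exact this.neg
  · intro g hg hgc
    have hg₁ : HasCompactSupport (Complex.ofRealCLM ∘ g) := hgc.comp_left rfl
    have hg₂ : ContDiff ℝ (⊤ : ℕ∞) (Complex.ofRealCLM ∘ g) := by fun_prop
    have h2 := congrArg (fun F : 𝓢'(Rn n, ℂ) => F (hg₁.toSchwartzMap hg₂)) h1
    have hgr : (fun x : Rn n => ((‖x‖ : ℂ)) ^ 2).HasTemperateGrowth := by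
      have : (fun x : Rn n => ((‖x‖ ^ 2 : ℝ) : ℂ)).HasTemperateGrowth := by fun_prop
      simpa using this
    simp only [Lp.toTemperedDistribution_apply, HasCompactSupport.toSchwartzMap_toFun,
      Function.comp_apply, Complex.ofRealCLM_apply, smul_eq_mul, Complex.ofReal_pow, smul_apply,
      TemperedDistribution.smulLeftCLM_apply_apply,
      SchwartzMap.smulLeftCLM_apply_apply hgr] at h2
    simp only [Complex.real_smul]
    rw [h2, Complex.real_smul, ← integral_const_mul]
    refine integral_congr_ae (Eventually.of_forall fun x => ?_)
    push_cast
    ring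

/-- Integration against a real function in `L²`, as a continuous linear functional on `L²`. -/
noncomputable def pairing {φ : Rn n → ℝ} (hφ : MemLp (fun x => (φ x : ℂ)) 2 volume) :
    L2 n →L[ℂ] ℂ :=
  innerSL ℂ (hφ.toLp _)

theorem pairing_apply {φ : Rn n → ℝ} (hφ : MemLp (fun x => (φ x : ℂ)) 2 volume) (f : L2 n) :
    pairing hφ f = ∫ x, φ x • f x := by
  rw [pairing, innerSL_apply_apply, L2.inner_def]
  refine integral_congr_ae ?_
  filter_upwards [hφ.coeFn_toLp] with x hx
  rw [hx]
  simp [mul_comm]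

theorem norm_pairing_le {φ : Rn n → ℝ} (hφ : MemLp (fun x => (φ x : ℂ)) 2 volume) (f : L2 n) :
    ‖pairing hφ f‖ ≤ ‖hφ.toLp _‖ * ‖f‖ :=
  norm_inner_le_norm (𝕜 := ℂ) (hφ.toLp _) f

theorem memLp_ofReal_of_hasCompactSupport {φ : Rn n → ℝ} (hc : Continuous φ)
    (hs : HasCompactSupport φ) : MemLp (fun x => (φ x : ℂ)) 2 volume :=
  (Complex.continuous_ofReal.comp hc).memLp_of_hasCompactSupport (hs.comp_left Complex.ofReal_zero)

theorem memLp_mul_pow {φ : Rn n → ℝ} (hc : Continuous φ) (hs : HasCompactSupport φ)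
    {m : Rn n → ℝ} (hm : Continuous m) (k : ℕ) :
    MemLp (fun x => ((φ x * m x ^ k : ℝ) : ℂ)) 2 volume :=
  memLp_ofReal_of_hasCompactSupport (hc.mul (hm.pow k)) hs.mul_right

/-- The moments of the Fourier transform of a solution against a test function satisfy a hierarchy
of Volterra equations. -/
theorem pairing_eq_volterra {γ T : ℝ} (hγ : γ ∈ Ioo (0 : ℝ) 1) {g : L2 n} {u : ℝ → L2 n}
    (hu : IsSolution γ T g u) {φ : Rn n → ℝ} (hc : Continuous φ) (hs : HasCompactSupport φ)
    (hm : Continuous fun η : Rn n => (2 * Real.pi) ^ 2 * ‖η‖ ^ 2)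
    (k : ℕ) {t : ℝ} (ht : t ∈ Ioo 0 T) :
    pairing (memLp_mul_pow hc hs hm k) (𝓕 (u t)) =
      pairing (memLp_mul_pow hc hs hm k) (𝓕 (u 0)) - (Real.Gamma γ)⁻¹ •
        ∫ s in (0 : ℝ)..t, (t - s) ^ (γ - 1) •
          pairing (memLp_mul_pow hc hs hm (k + 1)) (𝓕 (u s)) := by
  -- One continuous real-linear functional, so that the moment commutes with the time derivative and
  -- with the Bochner integral in the Caputo derivative.
  set Λ : L2 n →L[ℝ] ℂ := ((pairing (memLp_mul_pow hc hs hm k)).comp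
    (Lp.fourierTransformₗᵢ (Rn n) ℂ).toContinuousLinearEquiv.toContinuousLinearMap).restrictScalars ℝ
    with hΛ
  have hΛ_apply : ∀ f : L2 n, Λ f = pairing (memLp_mul_pow hc hs hm k) (𝓕 f) := fun f => rfl
  have h1γ : 0 < 1 - γ := by linarith [hγ.2]
  have hΓ := Real.Gamma_pos_of_pos hγ.1
  have hΓ' := Real.Gamma_pos_of_pos h1γ
  have hcap : ∀ s ∈ Ioo 0 T, ∫ r in (0 : ℝ)..s, (s - r) ^ (-γ) • Λ (deriv u r) =
      -(Real.Gamma (1 - γ) • pairing (memLp_mul_pow hc hs hm (k + 1)) (𝓕 (u s))) := by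
    intro s hs'
    have h1 : ∫ r in (0 : ℝ)..s, (s - r) ^ (-γ) • Λ (deriv u r) =
        Real.Gamma (1 - γ) • Λ (caputoDeriv γ u s) := by
      rw [caputoDeriv, map_smul, smul_smul, mul_one_div_cancel hΓ'.ne', one_smul,
        ← Λ.intervalIntegral_comp_comm (hu.integrable s hs')]
      simp
    have h2 : Λ (caputoDeriv γ u s) =
        -pairing (memLp_mul_pow hc hs hm (k + 1)) (𝓕 (u s)) := by
      rw [hΛ_apply, pairing_apply, pairing_apply, ← integral_neg]
      refine integral_congr_ae ?_
      filter_upwards [ae_fourier_eq_of_eq_laplacian (hu.equation s hs')] with η hη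
      rw [hη, smul_neg, smul_smul, pow_succ (_ * _) k, mul_assoc (φ η)]
    rw [h1, h2, smul_neg]
  have hsub : Icc 0 t ⊆ Icc 0 T := Icc_subset_Icc_right ht.2.le
  have hinv := integral_sub_rpow_smul_caputo hγ ht.1 (a := fun s => Λ (u s))
    (a' := fun s => Λ (deriv u s)) (Λ.continuous.comp_continuousOn (hu.continuousOn.mono hsub))
    (fun s hs' => Λ.hasFDerivAt.comp_hasDerivAt s
      (hu.differentiableAt s ⟨hs'.1, hs'.2.trans ht.2⟩).hasDerivAt) (by
      have h := hu.integrable t ht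
      have h2 : IntervalIntegrable (fun s => Λ ((t - s) ^ (-γ) • deriv u s)) volume 0 t :=
        ⟨Λ.integrable_comp h.1, Λ.integrable_comp h.2⟩
      simpa using h2)
  have hInt : ∫ s in (0 : ℝ)..t, (t - s) ^ (γ - 1) •
        ∫ r in (0 : ℝ)..s, (s - r) ^ (-γ) • Λ (deriv u r) =
      -(Real.Gamma (1 - γ) • ∫ s in (0 : ℝ)..t, (t - s) ^ (γ - 1) •
          pairing (memLp_mul_pow hc hs hm (k + 1)) (𝓕 (u s))) := by
    rw [← intervalIntegral.integral_smul, ← intervalIntegral.integral_neg,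
      intervalIntegral.integral_of_le ht.1.le, intervalIntegral.integral_of_le ht.1.le]
    refine setIntegral_congr_fun measurableSet_Ioc fun s hs' => ?_
    rw [hcap s ⟨hs'.1, hs'.2.trans_lt ht.2⟩, smul_neg, smul_comm]
  rw [hInt] at hinv
  have hfin : ∫ s in (0 : ℝ)..t, (t - s) ^ (γ - 1) •
      pairing (memLp_mul_pow hc hs hm (k + 1)) (𝓕 (u s)) =
      -(Real.Gamma γ • (Λ (u t) - Λ (u 0))) := by
    apply smul_right_injective ℂ hΓ'.ne'
    simp only
    rw [smul_neg, smul_smul, mul_comm (Real.Gamma _), ← hinv, neg_neg]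
  rw [hfin, smul_neg, smul_smul, inv_mul_cancel₀ hΓ.ne', one_smul, hΛ_apply, hΛ_apply]
  abel

/-- The Fourier transform of the final value of a solution is the Fourier transform of its initial
value times the Mittag-Leffler symbol. -/
theorem ae_fourier_final_eq {γ T : ℝ} (hγ : γ ∈ Ioo (0 : ℝ) 1) (hT : 0 < T) {g : L2 n}
    {u : ℝ → L2 n} (hu : IsSolution γ T g u) :
    ∀ᵐ η : Rn n, (𝓕 g : L2 n) η =
      mittagLeffler γ (-T ^ γ * ((2 * Real.pi) ^ 2 * ‖η‖ ^ 2)) • (𝓕 (u 0) : L2 n) η := by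
  set m : Rn n → ℝ := fun η => (2 * Real.pi) ^ 2 * ‖η‖ ^ 2 with hm_def
  have hm : Continuous m := by fun_prop
  have hm0 : ∀ η, 0 ≤ m η := fun η => by positivity
  have hloc : ∀ g : L2 n, LocallyIntegrable (g : Rn n → ℂ) volume := fun g =>
    (Lp.memLp g).locallyIntegrable (by norm_num)
  refine ae_eq_of_integral_contDiff_smul_eq (hloc _) ?_ ?_
  · have := ((hloc (𝓕 (u 0))).locallyIntegrableOn univ).continuousOn_smul
      isOpen_univ.isLocallyClosed
      (g := fun η : Rn n => mittagLeffler γ (-T ^ γ * m η))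
      ((continuous_mittagLeffler hγ.1).comp (continuous_const.mul hm)).continuousOn
    rwa [locallyIntegrableOn_univ] at this
  intro φ hφ hs
  have hc : Continuous φ := hφ.continuous
  obtain ⟨U, hU⟩ := isCompact_Icc.exists_bound_of_continuousOn hu.continuousOn
  -- Compact support of `φ` bounds `m` by `R` there, so the moments grow at most geometrically
  -- although `u` has limited regularity.
  obtain ⟨R, hR⟩ := hs.isCompact.exists_bound_of_continuousOn hm.continuousOn
  have hφR : ∀ (k : ℕ) (η : Rn n), |φ η * m η ^ k| ≤ R ^ k * |φ η| := by
    intro k η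
    by_cases hη : η ∈ tsupport φ
    · have h1 := hR η hη
      rw [Real.norm_of_nonneg (hm0 η)] at h1
      rw [abs_mul, abs_pow, abs_of_nonneg (hm0 η), mul_comm]
      exact mul_le_mul_of_nonneg_right (pow_le_pow_left₀ (hm0 η) h1 k) (abs_nonneg _)
    · simp [image_eq_zero_of_notMem_tsupport hη]
  set a : ℕ → ℝ → ℂ := fun k t => pairing (memLp_mul_pow hc hs hm k) (𝓕 (u t)) with ha
  have hlim := tendsto_sum_of_volterra (a := a) (R := R)
    (K := ‖(memLp_mul_pow hc hs hm 0).toLp _‖ * U) hγ.1 hT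
    (fun k => (pairing (memLp_mul_pow hc hs hm k)).continuous.comp_continuousOn
      ((Lp.fourierTransformₗᵢ (Rn n) ℂ).continuous.comp_continuousOn hu.continuousOn))
    (fun k t ht => pairing_eq_volterra hγ hu hc hs hm k ht) (by
      intro k t ht
      have h1 : ‖(memLp_mul_pow hc hs hm k).toLp _‖ ≤
          R ^ k * ‖(memLp_mul_pow hc hs hm 0).toLp _‖ := by
        refine Lp.norm_le_mul_norm_of_ae_le_mul ?_
        filter_upwards [(memLp_mul_pow hc hs hm k).coeFn_toLp,
          (memLp_mul_pow hc hs hm 0).coeFn_toLp] with η h1 h2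
        rw [h1, h2, Complex.norm_real, Complex.norm_real, pow_zero, mul_one]
        exact hφR k η
      refine (norm_pairing_le _ _).trans ?_
      rw [Lp.norm_fourier_eq]
      have h2 := hU t ⟨ht.1.le, ht.2.le⟩
      calc _ ≤ (R ^ k * ‖(memLp_mul_pow hc hs hm 0).toLp _‖) * U := by
            gcongr
            exact (norm_nonneg _).trans h1
        _ = _ := by ring)
  have hInt0 : Integrable (fun η => ‖φ η • (𝓕 (u 0) : L2 n) η‖) :=
    ((hloc (𝓕 (u 0))).integrable_smul_left_of_hasCompactSupport hc hs).norm
  have hInt : ∀ k : ℕ, Integrable (fun η => (φ η * m η ^ k) • (𝓕 (u 0) : L2 n) η) := fun k =>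
    (hloc (𝓕 (u 0))).integrable_smul_left_of_hasCompactSupport (hc.mul (hm.pow k)) hs.mul_right
  have hInt' : ∀ k : ℕ, Integrable (fun η => ((-T ^ γ) ^ k / Real.Gamma (γ * k + 1)) •
      ((φ η * m η ^ k) • (𝓕 (u 0) : L2 n) η)) := fun k =>
    (hInt k).fun_smul ((-T ^ γ) ^ k / Real.Gamma (γ * k + 1))
  have hle : ∀ (k : ℕ) (η : Rn n), ‖((-T ^ γ) ^ k / Real.Gamma (γ * k + 1)) •
      ((φ η * m η ^ k) • (𝓕 (u 0) : L2 n) η)‖ ≤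
      (T ^ γ * R) ^ k / Real.Gamma (γ * k + 1) * ‖φ η • (𝓕 (u 0) : L2 n) η‖ := by
    intro k η
    have hG := Gamma_mul_add_one_pos hγ.1 k
    have hTγ : 0 ≤ T ^ γ := by positivity
    simp only [norm_smul, Real.norm_eq_abs]
    rw [abs_div, abs_pow, abs_neg, abs_of_nonneg hTγ, abs_of_pos hG]
    calc _ ≤ (T ^ γ) ^ k / Real.Gamma (γ * k + 1) *
          ((R ^ k * |φ η|) * ‖(𝓕 (u 0) : L2 n) η‖) := by
          gcongr
          exact hφR k η
      _ = _ := by rw [mul_pow]; ring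
  have hsum := hasSum_integral_of_summable_integral_norm
    (F := fun (k : ℕ) η => ((-T ^ γ) ^ k / Real.Gamma (γ * k + 1)) •
      ((φ η * m η ^ k) • (𝓕 (u 0) : L2 n) η)) (μ := volume)
    hInt' (by
      refine Summable.of_nonneg_of_le (fun k => integral_nonneg fun η => norm_nonneg _) ?_
        ((summable_mittagLeffler hγ.1 (T ^ γ * R)).mul_right
          (∫ η, ‖φ η • (𝓕 (u 0) : L2 n) η‖))
      intro k
      rw [← integral_const_mul]
      exact integral_mono (hInt' k).norm (hInt0.const_mul _) (hle k))
  -- The same partial sums converge to the moment of `u T` by the Volterra hierarchy, and to the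
  -- integral of the summed series by termwise integration.
  have huniq := tendsto_nhds_unique hlim (by
    have := hsum.tendsto_sum_nat
    simp only [integral_smul] at this
    simpa only [ha, pairing_apply] using this)
  simp only [ha, pairing_apply, pow_zero, mul_one, hu.final] at huniq
  rw [huniq]
  refine integral_congr_ae (Eventually.of_forall fun η => ?_)
  simp only
  have : ∀ k : ℕ, ((-T ^ γ) ^ k / Real.Gamma (γ * k + 1)) •
      ((φ η * m η ^ k) • (𝓕 (u 0) : L2 n) η) =
      ((-T ^ γ * m η) ^ k / Real.Gamma (γ * k + 1)) • (φ η • (𝓕 (u 0) : L2 n) η) := by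
    intro k
    rw [smul_smul, smul_smul, mul_pow (-T ^ γ)]
    congr 1
    ring
  simp_rw [this]
  rw [(summable_mittagLeffler hγ.1 _).tsum_smul_const, smul_comm, mittagLeffler]

end FracDiffusion

/-! ### The rescaled Fourier transform -/

namespace FracDiffusion

variable {n : ℕ}

theorem map_smul_volume {r : ℝ} (hr : 0 < r) :
    Measure.map (fun ξ : Rn n => r • ξ) volume = ENNReal.ofReal ((r ^ n)⁻¹) • volume := by
  rw [Measure.map_addHaar_smul volume hr.ne', finrank_euclideanSpace_fin,
    abs_of_pos (by positivity)]

theorem quasiMeasurePreserving_smul {r : ℝ} (hr : 0 < r) :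
    Measure.QuasiMeasurePreserving (fun ξ : Rn n => r • ξ) volume volume :=
  ⟨measurable_const_smul r, by
    rw [map_smul_volume hr]
    exact Measure.smul_absolutelyContinuous⟩

theorem memLp_comp_smul {r : ℝ} (hr : 0 < r) {f : Rn n → ℂ} (hf : MemLp f 2 volume) :
    MemLp (fun ξ => f (r • ξ)) 2 volume := by
  have h : MemLp f 2 (Measure.map (fun ξ : Rn n => r • ξ) volume) := by
    rw [map_smul_volume hr]
    exact hf.smul_measure ENNReal.ofReal_ne_top
  exact h.comp_of_map (measurable_const_smul r).aemeasurable

theorem memLp_fourierHat (f : L2 n) : MemLp (fourierHat f) 2 volume :=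
  (memLp_comp_smul (r := (2 * Real.pi)⁻¹) (by positivity)
    (Lp.memLp (𝓕 f : L2 n))).const_smul (((√(2 * Real.pi)) ^ n)⁻¹ : ℝ)

/-- Plancherel: the factor `(2π)^(n/2)` from the dilation cancels the normalization. -/
theorem eLpNorm_fourierHat (f : L2 n) :
    eLpNorm (fourierHat f) 2 volume = ENNReal.ofReal ‖f‖ := by
  have hpi : 0 < (2 * Real.pi)⁻¹ := by positivity
  have h1 : eLpNorm (fun ξ : Rn n => (𝓕 f : L2 n) ((2 * Real.pi)⁻¹ • ξ)) 2 volume =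
      ENNReal.ofReal ((√(2 * Real.pi)) ^ n) * ENNReal.ofReal ‖f‖ := by
    have h2 := eLpNorm_map_measure (μ := (volume : Measure (Rn n))) (p := 2)
      (f := fun ξ : Rn n => (2 * Real.pi)⁻¹ • ξ) (g := ((𝓕 f : L2 n) : Rn n → ℂ)) (by
        rw [map_smul_volume hpi]
        exact (Lp.aestronglyMeasurable _).smul_measure _)
      (measurable_const_smul _).aemeasurable
    rw [map_smul_volume hpi, eLpNorm_smul_measure_of_ne_top (by norm_num)] at h2
    rw [Function.comp_def] at h2
    rw [← h2, ← Lp.norm_fourier_eq f, Lp.norm_def, ENNReal.ofReal_toReal (Lp.eLpNorm_ne_top _),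
      smul_eq_mul]
    congr 1
    rw [ENNReal.ofReal_rpow_of_pos (by positivity)]
    congr 1
    rw [inv_pow, inv_inv, Real.sqrt_eq_rpow, ← Real.rpow_natCast, ← Real.rpow_natCast,
      ← Real.rpow_mul (by positivity), ← Real.rpow_mul (by positivity)]
    congr 1
    simp
    ring
  have hc : 0 < (√(2 * Real.pi)) ^ n := by positivity
  have hfun : fourierHat f = (((√(2 * Real.pi)) ^ n)⁻¹ : ℝ) •
      fun ξ : Rn n => (𝓕 f : L2 n) ((2 * Real.pi)⁻¹ • ξ) := rfl
  rw [hfun, eLpNorm_const_smul, h1, Real.enorm_of_nonneg (by positivity), ← mul_assoc,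
    ← ENNReal.ofReal_mul (by positivity), inv_mul_cancel₀ hc.ne', ENNReal.ofReal_one, one_mul]

theorem fourierHat_sub (f g : L2 n) :
    ∀ᵐ ξ, fourierHat (f - g) ξ = fourierHat f ξ - fourierHat g ξ := by
  have h : (𝓕 (f - g) : L2 n) = 𝓕 f - 𝓕 g := map_sub (Lp.fourierTransformₗᵢ (Rn n) ℂ) f g
  have h2 := (quasiMeasurePreserving_smul (n := n) (r := (2 * Real.pi)⁻¹) (by positivity)).ae
    (Lp.coeFn_sub (𝓕 f : L2 n) (𝓕 g))
  filter_upwards [h2] with ξ hξ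
  rw [fourierHat, h, hξ, Pi.sub_apply, smul_sub]
  rfl

theorem eq_of_fourierHat_ae_eq {f g : L2 n} (h : ∀ᵐ ξ, fourierHat f ξ = fourierHat g ξ) :
    f = g := by
  have h1 : eLpNorm (fourierHat (f - g)) 2 volume = 0 := by
    rw [eLpNorm_eq_zero_iff (memLp_fourierHat _).aestronglyMeasurable (by norm_num)]
    filter_upwards [h, fourierHat_sub f g] with ξ h1 h2
    rw [h2, h1, sub_self, Pi.zero_apply]
  rw [eLpNorm_fourierHat, ENNReal.ofReal_eq_zero] at h1
  exact sub_eq_zero.1 (norm_le_zero_iff.1 h1)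

theorem exists_fourierHat_ae_eq {V : Rn n → ℂ} (hV : MemLp V 2 volume) :
    ∃ v : L2 n, ∀ᵐ ξ, fourierHat v ξ = V ξ := by
  have hF : MemLp (fun η : Rn n => ((√(2 * Real.pi)) ^ n : ℝ) • V ((2 * Real.pi) • η)) 2 volume :=
    (memLp_comp_smul (r := 2 * Real.pi) (by positivity) hV).const_smul ((√(2 * Real.pi)) ^ n : ℝ)
  refine ⟨𝓕⁻ (hF.toLp _), ?_⟩
  filter_upwards [(quasiMeasurePreserving_smul (n := n) (r := (2 * Real.pi)⁻¹) (by positivity)).ae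
    hF.coeFn_toLp] with ξ hξ
  have hpi : (2 * Real.pi) ≠ 0 := by positivity
  have hc : (√(2 * Real.pi)) ^ n ≠ 0 := by positivity
  rw [fourierHat, FourierTransform.fourier_fourierInv_eq, hξ, smul_smul, smul_smul,
    mul_inv_cancel₀ hpi, inv_mul_cancel₀ hc, one_smul, one_smul]

theorem ae_fourierHat_final_eq {γ T : ℝ} (hγ : γ ∈ Ioo (0 : ℝ) 1) (hT : 0 < T) {g : L2 n}
    {u : ℝ → L2 n} (hu : IsSolution γ T g u) :
    ∀ᵐ ξ : Rn n, fourierHat g ξ =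
      (mittagLeffler γ (-‖ξ‖ ^ 2 * T ^ γ) : ℂ) * fourierHat (u 0) ξ := by
  filter_upwards [(quasiMeasurePreserving_smul (n := n) (r := (2 * Real.pi)⁻¹) (by positivity)).ae
    (ae_fourier_final_eq hγ hT hu)] with ξ hξ
  have hpi : 0 < 2 * Real.pi := by positivity
  have : -T ^ γ * ((2 * Real.pi) ^ 2 * ‖(2 * Real.pi)⁻¹ • ξ‖ ^ 2) = -‖ξ‖ ^ 2 * T ^ γ := by
    rw [norm_smul, Real.norm_of_nonneg (by positivity)]
    field_simp
  rw [fourierHat, hξ, this, fourierHat, smul_comm, Complex.real_smul]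

/-! ### Estimates of the symbol and of the mollified weights -/

theorem IsApproxSymbol.ae_abs_sub_le {γ T h : ℝ} (hγ : γ ∈ Ioo (0 : ℝ) 1) (hT : 0 < T)
    (hh : 0 ≤ h) {ψ : ℝ → ℝ → ℝ} (hψ : IsApproxSymbol n γ T h ψ) :
    ∀ᵐ ξ : Rn n, |ψ ‖ξ‖ T - mittagLeffler γ (-‖ξ‖ ^ 2 * T ^ γ)| ≤
      h * mittagLeffler γ (-‖ξ‖ ^ 2 * T ^ γ) := by
  have he := hψ.error_le T ⟨hT, le_rfl⟩
  rw [eLpNorm_exponent_top] at he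
  filter_upwards [ae_le_eLpNormEssSup (μ := (volume : Measure (Rn n))) (f := fun ξ : Rn n =>
      (ψ ‖ξ‖ T - mittagLeffler γ (-‖ξ‖ ^ 2 * T ^ γ)) / mittagLeffler γ (-‖ξ‖ ^ 2 * T ^ γ))]
    with ξ hξ
  have h1 := hξ.trans he
  rw [← ofReal_norm, ENNReal.ofReal_le_ofReal_iff hh, norm_div, Real.norm_eq_abs,
    Real.norm_eq_abs] at h1
  have hpos : 0 < mittagLeffler γ (-‖ξ‖ ^ 2 * T ^ γ) := by
    have := inv_le_mittagLeffler_neg hγ (x := ‖ξ‖ ^ 2 * T ^ γ) (by positivity)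
    rw [neg_mul]
    refine lt_of_lt_of_le ?_ this
    have := Real.Gamma_pos_of_pos (show 0 < 1 - γ by linarith [hγ.2])
    positivity
  rwa [abs_of_pos hpos, div_le_iff₀ hpos] at h1

/-- For `x ≤ 1` use `1 - exp(-y) ≤ y` and `x^s ≤ x^q`; for `x ≥ 1` the left side is below `1`. The
restriction `p - l ≤ s` of the theorem enters here, with `q = p - l`. -/
theorem one_sub_exp_neg_mul_rpow_le {τ s q x : ℝ} (hτ : 0 < τ) (hq : 0 ≤ q) (hqs : q ≤ s)
    (hx : 0 ≤ x) : 1 - Real.exp (-τ * x ^ s) ≤ (1 + τ) * x ^ q := by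
  have hxq : 0 ≤ x ^ q := Real.rpow_nonneg hx _
  rcases le_total x 1 with h | h
  · have h1 := Real.add_one_le_exp (-τ * x ^ s)
    have h2 : x ^ s ≤ x ^ q := Real.rpow_le_rpow_of_exponent_ge' hx h hq hqs
    nlinarith
  · have h1 := Real.exp_pos (-τ * x ^ s)
    have h2 : 1 ≤ x ^ q := Real.one_le_rpow h hq
    nlinarith

theorem exists_one_add_sq_rpow_mul_exp_le {τ s r : ℝ} (hτ : 0 < τ) (hs : 0 < s) (hr : 0 < r) :
    ∃ C : ℝ, 0 < C ∧ ∀ x : ℝ, 0 ≤ x → (1 + x ^ 2) ^ r * Real.exp (-τ * x ^ s) ≤ C := by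
  -- With `2r ≤ sN`, the bound `y^N / N! ≤ exp y` at `y = τ x^s` dominates `x^(2r)`.
  obtain ⟨N, hN⟩ := exists_nat_ge (2 * r / s)
  rw [div_le_iff₀ hs] at hN
  refine ⟨2 ^ r * (1 + N.factorial / τ ^ N), by positivity, fun x hx => ?_⟩
  rcases le_total x 1 with h | h
  · calc (1 + x ^ 2) ^ r * Real.exp (-τ * x ^ s) ≤ 2 ^ r * 1 := by
          gcongr
          · nlinarith
          · rw [Real.exp_le_one_iff]
            have := Real.rpow_nonneg hx s
            nlinarith
      _ ≤ _ := by
          gcongr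
          have : 0 ≤ N.factorial / τ ^ N := by positivity
          linarith
  · have hx0 : 0 < x := by linarith
    have h1 : (1 + x ^ 2) ^ r ≤ 2 ^ r * (x ^ s) ^ N := by
      calc (1 + x ^ 2) ^ r ≤ (2 * x ^ 2) ^ r := by
            gcongr
            nlinarith
        _ = 2 ^ r * x ^ (2 * r) := by
            rw [Real.mul_rpow (by norm_num) (by positivity), ← Real.rpow_natCast x 2,
              ← Real.rpow_mul hx]
            norm_num
        _ ≤ 2 ^ r * x ^ (s * N) := by
            refine mul_le_mul_of_nonneg_left (Real.rpow_le_rpow_of_exponent_le h ?_) (by positivity)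
            linarith
        _ = _ := by rw [Real.rpow_mul hx, Real.rpow_natCast]
    have h2 := Real.pow_div_factorial_le_exp (τ * x ^ s) (by positivity) N
    rw [div_le_iff₀ (by positivity), mul_pow] at h2
    have h3 : (x ^ s) ^ N ≤ N.factorial / τ ^ N * Real.exp (τ * x ^ s) := by
      rw [div_mul_eq_mul_div, le_div_iff₀ (by positivity)]
      linarith
    have h4 : Real.exp (τ * x ^ s) * Real.exp (-τ * x ^ s) = 1 := by
      rw [← Real.exp_add]
      simp
    calc (1 + x ^ 2) ^ r * Real.exp (-τ * x ^ s)
        ≤ (2 ^ r * (N.factorial / τ ^ N * Real.exp (τ * x ^ s))) * Real.exp (-τ * x ^ s) := by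
          gcongr
          exact h1.trans (by gcongr)
      _ = 2 ^ r * (N.factorial / τ ^ N) := by linear_combination (2 ^ r * (N.factorial / τ ^ N)) * h4
      _ ≤ _ := by
          gcongr
          linarith

/-- Removing the mollifier costs a factor `α ^ (p - l)` between `H^p` and `H^l`. -/
theorem weight_mul_one_sub_exp_le {τ s p l α z : ℝ} (hτ : 0 < τ) (hlp : l ≤ p) (hpl : p - l ≤ s)
    (hα : 0 ≤ α) (hz : 0 ≤ z) :
    (1 + z ^ 2) ^ (l / 2) * (1 - Real.exp (-τ * (α * z) ^ s)) ≤
      (1 + τ) * α ^ (p - l) * (1 + z ^ 2) ^ (p / 2) := by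
  have hq : 0 ≤ p - l := sub_nonneg.2 hlp
  have h1 := one_sub_exp_neg_mul_rpow_le hτ hq hpl (mul_nonneg hα hz)
  have hb : 0 < 1 + z ^ 2 := by positivity
  have h2 : z ^ (p - l) ≤ (1 + z ^ 2) ^ ((p - l) / 2) := by
    calc z ^ (p - l) = (z ^ 2) ^ ((p - l) / 2) := by
          rw [← Real.rpow_natCast z 2, ← Real.rpow_mul hz]
          congr 1
          push_cast
          ring
      _ ≤ _ := by
          gcongr
          linarith
  have h3 : (1 + z ^ 2) ^ (l / 2) * (1 + z ^ 2) ^ ((p - l) / 2) = (1 + z ^ 2) ^ (p / 2) := by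
    rw [← Real.rpow_add hb]
    congr 1
    ring
  rw [Real.mul_rpow (z := p - l) hα hz] at h1
  have hα' : 0 ≤ α ^ (p - l) := Real.rpow_nonneg hα _
  calc _ ≤ (1 + z ^ 2) ^ (l / 2) * ((1 + τ) * (α ^ (p - l) * (1 + z ^ 2) ^ ((p - l) / 2))) := by
        gcongr
        exact h1.trans (by gcongr)
    _ = _ := by rw [← h3]; ring

/-- The mollified weight of order `l + 2` grows at most like `α ^ (-(l + 2))`. -/
theorem exists_weight_mul_exp_le {τ s p A : ℝ} (hτ : 0 < τ) (hs : 0 < s) (hp : 0 < p)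
    (hA : 1 ≤ A) :
    ∃ C : ℝ, 0 < C ∧ ∀ α l z : ℝ, 0 < α → α ≤ A → 0 ≤ l → l ≤ p → 0 ≤ z →
      (1 + z ^ 2) ^ (l / 2) * (1 + z ^ 2) * Real.exp (-τ * (α * z) ^ s) ≤ C * α ^ (-(l + 2)) := by
  obtain ⟨C, hC, h⟩ := exists_one_add_sq_rpow_mul_exp_le (r := (p + 2) / 2) hτ hs (by linarith)
  refine ⟨(A ^ 2) ^ ((p + 2) / 2) * C, by positivity, fun α l z hα hαA hl hlp hz => ?_⟩
  have hb : 0 < 1 + z ^ 2 := by positivity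
  have e1 : (1 + z ^ 2) ^ (l / 2) * (1 + z ^ 2) = (1 + z ^ 2) ^ ((l + 2) / 2) := by
    rw [← Real.rpow_add_one hb.ne']
    congr 1
    ring
  have e2 : α ^ (l + 2) = (α ^ 2) ^ ((l + 2) / 2) := by
    rw [← Real.rpow_natCast α 2, ← Real.rpow_mul hα.le]
    congr 1
    push_cast
    ring
  have h1 : α ^ 2 * (1 + z ^ 2) ≤ A ^ 2 * (1 + (α * z) ^ 2) := by
    nlinarith [pow_le_pow_left₀ hα.le hαA 2, sq_nonneg (α * z), one_le_pow₀ hA (n := 2)]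
  -- A base of at least `1` allows the exponent `(l+2)/2` to be raised to `(p+2)/2`, which makes the
  -- constant uniform in `l`.
  have h2 : 1 ≤ A ^ 2 * (1 + (α * z) ^ 2) := by
    nlinarith [sq_nonneg (α * z), one_le_pow₀ hA (n := 2)]
  have h3 : α ^ (l + 2) * (1 + z ^ 2) ^ ((l + 2) / 2) ≤
      (A ^ 2) ^ ((p + 2) / 2) * (1 + (α * z) ^ 2) ^ ((p + 2) / 2) := by
    rw [e2, ← Real.mul_rpow (by positivity) (by positivity),
      ← Real.mul_rpow (by positivity) (by positivity)]
    calc _ ≤ (A ^ 2 * (1 + (α * z) ^ 2)) ^ ((l + 2) / 2) := by gcongr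
      _ ≤ _ := Real.rpow_le_rpow_of_exponent_le h2 (by linarith)
  rw [e1, Real.rpow_neg hα.le, ← div_eq_mul_inv, le_div_iff₀ (by positivity)]
  calc _ = α ^ (l + 2) * (1 + z ^ 2) ^ ((l + 2) / 2) * Real.exp (-τ * (α * z) ^ s) := by ring
    _ ≤ (A ^ 2) ^ ((p + 2) / 2) * (1 + (α * z) ^ 2) ^ ((p + 2) / 2) *
        Real.exp (-τ * (α * z) ^ s) := by gcongr
    _ ≤ _ := by
        rw [mul_assoc]
        gcongr
        exact h _ (by positivity)

end FracDiffusion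

/-! ### The error of the regularized initial value -/

namespace FracDiffusion

variable {n : ℕ}

theorem half_le_of_abs_sub_le {e ψ h : ℝ} (he : 0 < e) (hh : h ≤ 1 / 2)
    (hψe : |ψ - e| ≤ h * e) : e / 2 ≤ ψ := by
  nlinarith [(abs_le.1 hψe).1]

/-- The pointwise splitting into mollification error, symbol error and data error. The bound `h ≤
1/2` keeps `ψ ≥ e/2`, so dividing by `ψ` instead of `e` costs a factor `2`. -/
theorem norm_sub_mollified_quotient_le {e ψ h κ : ℝ} {x d : ℂ} (he : 0 < e) (hh : h ≤ 1 / 2)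
    (hψe : |ψ - e| ≤ h * e) (hκ : 0 ≤ κ) (hκ1 : κ ≤ 1) :
    ‖x - κ * ((e * x - d) / ψ)‖ ≤ ((1 - κ) + 2 * h) * ‖x‖ + κ * (2 / e) * ‖d‖ := by
  have hψ2 := half_le_of_abs_sub_le he hh hψe
  have hψ : 0 < ψ := by linarith
  have hψc : (ψ : ℂ) ≠ 0 := by exact_mod_cast hψ.ne'
  have key : x - κ * ((e * x - d) / ψ) =
      ((1 - κ : ℝ) : ℂ) * x + ((κ * ((ψ - e) / ψ) : ℝ) : ℂ) * x + ((κ / ψ : ℝ) : ℂ) * d := by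
    push_cast
    field_simp
    ring
  have h1 : |(ψ - e) / ψ| ≤ 2 * h := by
    rw [abs_div, abs_of_pos hψ, div_le_iff₀ hψ]
    nlinarith [(abs_nonneg (ψ - e)).trans hψe]
  have h2 : κ / ψ ≤ κ * (2 / e) := by
    rw [div_eq_mul_inv]
    gcongr
    rw [inv_le_comm₀ hψ (by positivity), inv_div]
    exact hψ2
  have h3 : κ * |(ψ - e) / ψ| ≤ 2 * h := by
    nlinarith [abs_nonneg ((ψ - e) / ψ)]
  rw [key]
  refine (norm_add₃_le).trans ?_
  simp only [norm_mul, Complex.norm_real, Real.norm_eq_abs]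
  rw [abs_of_nonneg (sub_nonneg.2 hκ1), abs_of_nonneg hκ,
    abs_of_nonneg (show 0 ≤ κ / ψ by positivity)]
  nlinarith [mul_le_mul_of_nonneg_right h2 (norm_nonneg d),
    mul_le_mul_of_nonneg_right h3 (norm_nonneg x)]

theorem two_div_mittagLeffler_le {γ T : ℝ} (hγ : γ ∈ Ioo (0 : ℝ) 1) (hT : 0 < T) (z : ℝ) :
    0 < mittagLeffler γ (-z ^ 2 * T ^ γ) ∧ 2 / mittagLeffler γ (-z ^ 2 * T ^ γ) ≤
      2 * (1 + Real.Gamma (1 - γ) * T ^ γ) * (1 + z ^ 2) := by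
  have hΓ := Real.Gamma_pos_of_pos (show 0 < 1 - γ by linarith [hγ.2])
  have h := inv_le_mittagLeffler_neg hγ (x := z ^ 2 * T ^ γ) (by positivity)
  rw [← neg_mul] at h
  have hden : 0 < 1 + Real.Gamma (1 - γ) * (z ^ 2 * T ^ γ) := by positivity
  have hpos := (inv_pos.2 hden).trans_le h
  refine ⟨hpos, ?_⟩
  rw [inv_le_comm₀ hden hpos] at h
  have hTγ : 0 < Real.Gamma (1 - γ) * T ^ γ := by positivity
  rw [div_eq_mul_inv]
  nlinarith [sq_nonneg z]

/-- The Fourier transform of the regularized initial value. -/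
noncomputable def regularizedHat (τ s T α : ℝ) (ψ : ℝ → ℝ → ℝ) (gδ : L2 n) (ξ : Rn n) : ℂ :=
  (((√(2 * Real.pi)) ^ n * kernelHat τ s (α • ξ) : ℝ) : ℂ) *
    (fourierHat gδ ξ / ((ψ ‖ξ‖ T : ℝ) : ℂ))

theorem exp_neg_mul_rpow_le_one {τ s x : ℝ} (hτ : 0 < τ) (hx : 0 ≤ x) :
    Real.exp (-τ * x ^ s) ≤ 1 := by
  rw [Real.exp_le_one_iff]
  have : 0 ≤ x ^ s := by positivity
  nlinarith

theorem ae_norm_sub_regularizedHat_le {γ T τ s α h : ℝ} (hγ : γ ∈ Ioo (0 : ℝ) 1) (hT : 0 < T)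
    (hτ : 0 < τ) (hα : 0 ≤ α) (hh0 : 0 ≤ h) (hh : h ≤ 1 / 2) {ψ : ℝ → ℝ → ℝ}
    (hψ : IsApproxSymbol n γ T h ψ) {g : L2 n} (gδ : L2 n) {u : ℝ → L2 n}
    (hu : IsSolution γ T g u) :
    ∀ᵐ ξ : Rn n, ‖fourierHat (u 0) ξ - regularizedHat τ s T α ψ gδ ξ‖ ≤
      ((1 - Real.exp (-τ * (α * ‖ξ‖) ^ s)) + 2 * h) * ‖fourierHat (u 0) ξ‖ +
        2 * (1 + Real.Gamma (1 - γ) * T ^ γ) *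
          ((1 + ‖ξ‖ ^ 2) * Real.exp (-τ * (α * ‖ξ‖) ^ s)) * ‖fourierHat (g - gδ) ξ‖ := by
  filter_upwards [fourierHat_sub g gδ, ae_fourierHat_final_eq hγ hT hu,
    hψ.ae_abs_sub_le hγ hT hh0] with ξ h2 h3 h4
  obtain ⟨he, he2⟩ := two_div_mittagLeffler_le hγ hT ‖ξ‖
  set e := mittagLeffler γ (-‖ξ‖ ^ 2 * T ^ γ)
  set κ := Real.exp (-τ * (α * ‖ξ‖) ^ s) with hκ
  have hker : (√(2 * Real.pi)) ^ n * kernelHat τ s (α • ξ) = κ := by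
    have : (√(2 * Real.pi)) ^ n ≠ 0 := by positivity
    rw [kernelHat, mul_inv_cancel_left₀ this, norm_smul, Real.norm_of_nonneg hα]
  have hκ1 : κ ≤ 1 := exp_neg_mul_rpow_le_one hτ (by positivity)
  have hκ0 : 0 ≤ κ := (Real.exp_pos _).le
  have hgd : fourierHat gδ ξ = e * fourierHat (u 0) ξ - fourierHat (g - gδ) ξ := by
    rw [h2, h3]
    ring
  have hmain := norm_sub_mollified_quotient_le (x := fourierHat (u 0) ξ)
    (d := fourierHat (g - gδ) ξ) he hh h4 hκ0 hκ1
  rw [← hgd] at hmain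
  rw [regularizedHat, hker]
  refine hmain.trans (add_le_add le_rfl (mul_le_mul_of_nonneg_right ?_ (norm_nonneg _)))
  calc κ * (2 / e) ≤ κ * (2 * (1 + Real.Gamma (1 - γ) * T ^ γ) * (1 + ‖ξ‖ ^ 2)) :=
        mul_le_mul_of_nonneg_left he2 hκ0
    _ = _ := by ring

/-- At `α = 0` nothing damps the factor `1 + |ξ|²`, so the data term has to vanish by itself. This
lets the estimates below treat `α = 0` and `α > 0` together. -/
theorem ae_fourierHat_sub_eq_zero (α : ℝ) {g gδ : L2 n} (hgα : α = 0 → g = gδ) :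
    ∀ᵐ ξ : Rn n, α = 0 → fourierHat (g - gδ) ξ = 0 := by
  filter_upwards [fourierHat_sub g gδ] with ξ hξ hα
  rw [hξ, hgα hα, sub_self]

/-- The error of the regularized initial value in `H^l`, in terms of the regularization parameter:
`C` bounds the mollified weights. -/
theorem sobolevNorm_sub_le {γ T τ s p l α h δ E C : ℝ} (hγ : γ ∈ Ioo (0 : ℝ) 1) (hT : 0 < T)
    (hτ : 0 < τ) (hC : 0 < C) (hlp : l ≤ p) (hpl : p - l ≤ s)
    (hα : 0 ≤ α) (hh0 : 0 ≤ h) (hh : h ≤ 1 / 2) (hE : 0 < E) (hδ : 0 ≤ δ)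
    (hweight : 0 < α → ∀ z : ℝ, 0 ≤ z →
      (1 + z ^ 2) ^ (l / 2) * (1 + z ^ 2) * Real.exp (-τ * (α * z) ^ s) ≤ C * α ^ (-(l + 2)))
    {ψ : ℝ → ℝ → ℝ} (hψ : IsApproxSymbol n γ T h ψ) {g gδ v : L2 n} {u : ℝ → L2 n}
    (hu : IsSolution γ T g u) (hu0 : sobolevNorm p (u 0) ≤ ENNReal.ofReal E)
    (hg : ‖g - gδ‖ ≤ δ) (hgα : α = 0 → g = gδ) (hv : IsRegularizedInitial τ s T α ψ gδ v) :
    sobolevNorm l (u 0 - v) ≤ ENNReal.ofReal (((1 + τ) * α ^ (p - l) + 2 * h) * E +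
      2 * (1 + Real.Gamma (1 - γ) * T ^ γ) * (C * α ^ (-(l + 2))) * δ) := by
  have hΓ := Real.Gamma_pos_of_pos (show 0 < 1 - γ by linarith [hγ.2])
  set D := 2 * (1 + Real.Gamma (1 - γ) * T ^ γ) with hD
  have hD0 : 0 < D := by positivity
  set A := (1 + τ) * α ^ (p - l) + 2 * h with hA
  set B := D * (C * α ^ (-(l + 2))) with hB
  have hA0 : 0 ≤ A := by positivity
  have hB0 : 0 ≤ B := by positivity
  have hd0 := ae_fourierHat_sub_eq_zero α hgα
  have hptw : ∀ᵐ ξ : Rn n,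
      ‖(((1 + ‖ξ‖ ^ 2) ^ (l / 2) : ℝ) : ℂ) * fourierHat (u 0 - v) ξ‖ ≤
        A * ‖(((1 + ‖ξ‖ ^ 2) ^ (p / 2) : ℝ) : ℂ) * fourierHat (u 0) ξ‖ +
          B * ‖fourierHat (g - gδ) ξ‖ := by
    filter_upwards [hd0, fourierHat_sub (u 0) v, hv,
      ae_norm_sub_regularizedHat_le (s := s) hγ hT hτ hα hh0 hh hψ gδ hu] with ξ h0 h1 h2 hmain
    have h3 : fourierHat (u 0 - v) ξ = fourierHat (u 0) ξ - regularizedHat τ s T α ψ gδ ξ := by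
      rw [h1, h2, regularizedHat]
    rw [← h3] at hmain
    set κ := Real.exp (-τ * (α * ‖ξ‖) ^ s) with hκ
    set W := (1 + ‖ξ‖ ^ 2) ^ (l / 2)
    set W' := (1 + ‖ξ‖ ^ 2) ^ (p / 2)
    have hW : 0 ≤ W := by positivity
    have hW' : 0 ≤ W' := by positivity
    have hWW' : W ≤ W' := Real.rpow_le_rpow_of_exponent_le (by nlinarith [sq_nonneg ‖ξ‖])
      (by linarith)
    have hfirst : W * ((1 - κ) + 2 * h) ≤ A * W' := by
      have := weight_mul_one_sub_exp_le hτ hlp hpl hα (norm_nonneg ξ)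
      rw [hA]
      nlinarith
    have hsecond : W * (D * ((1 + ‖ξ‖ ^ 2) * κ)) * ‖fourierHat (g - gδ) ξ‖ ≤
        B * ‖fourierHat (g - gδ) ξ‖ := by
      rcases hα.eq_or_lt with hα0 | hα0
      · simp [h0 hα0.symm]
      · refine mul_le_mul_of_nonneg_right ?_ (norm_nonneg _)
        calc W * (D * ((1 + ‖ξ‖ ^ 2) * κ)) = D * (W * (1 + ‖ξ‖ ^ 2) * κ) := by ring
          _ ≤ B := mul_le_mul_of_nonneg_left (hweight hα0 _ (norm_nonneg ξ)) hD0.le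
    rw [norm_mul, norm_mul, Complex.norm_real, Complex.norm_real, Real.norm_of_nonneg hW,
      Real.norm_of_nonneg hW']
    calc W * ‖fourierHat (u 0 - v) ξ‖
        ≤ W * (((1 - κ) + 2 * h) * ‖fourierHat (u 0) ξ‖ +
          D * ((1 + ‖ξ‖ ^ 2) * κ) * ‖fourierHat (g - gδ) ξ‖) := by gcongr
      _ = W * ((1 - κ) + 2 * h) * ‖fourierHat (u 0) ξ‖ +
          W * (D * ((1 + ‖ξ‖ ^ 2) * κ)) * ‖fourierHat (g - gδ) ξ‖ := by ring
      _ ≤ A * W' * ‖fourierHat (u 0) ξ‖ + B * ‖fourierHat (g - gδ) ξ‖ := by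
          gcongr
      _ = _ := by ring
  have hwm : AEStronglyMeasurable (fun ξ : Rn n =>
      (((1 + ‖ξ‖ ^ 2) ^ (p / 2) : ℝ) : ℂ) * fourierHat (u 0) ξ) volume := by
    refine AEStronglyMeasurable.mul (Measurable.aestronglyMeasurable ?_)
      (memLp_fourierHat _).aestronglyMeasurable
    fun_prop
  have hdm := (memLp_fourierHat (g - gδ)).aestronglyMeasurable
  calc sobolevNorm l (u 0 - v)
      ≤ eLpNorm (fun ξ : Rn n =>
        A * ‖(((1 + ‖ξ‖ ^ 2) ^ (p / 2) : ℝ) : ℂ) * fourierHat (u 0) ξ‖ +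
          B * ‖fourierHat (g - gδ) ξ‖) 2 volume := eLpNorm_mono_ae_real hptw
    _ ≤ eLpNorm (A • fun ξ : Rn n =>
          ‖(((1 + ‖ξ‖ ^ 2) ^ (p / 2) : ℝ) : ℂ) * fourierHat (u 0) ξ‖) 2 volume +
        eLpNorm (B • fun ξ : Rn n => ‖fourierHat (g - gδ) ξ‖) 2 volume :=
        eLpNorm_add_le (hwm.norm.const_smul A) (hdm.norm.const_smul B) (by norm_num)
    _ = ENNReal.ofReal A * sobolevNorm p (u 0) +
        ENNReal.ofReal B * ENNReal.ofReal ‖g - gδ‖ := by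
        rw [eLpNorm_const_smul, eLpNorm_const_smul, eLpNorm_norm, eLpNorm_norm,
          eLpNorm_fourierHat, Real.enorm_of_nonneg hA0, Real.enorm_of_nonneg hB0]
        rfl
    _ ≤ ENNReal.ofReal A * ENNReal.ofReal E + ENNReal.ofReal B * ENNReal.ofReal δ := by
        gcongr
    _ = _ := by
        rw [← ENNReal.ofReal_mul hA0, ← ENNReal.ofReal_mul hB0, ← ENNReal.ofReal_add
          (by positivity) (by positivity)]

/-- The prescribed transform differs from `û₀` by a function with an `L²` majorant, hence is itself
in `L²`; this also covers `α = 0`. -/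
theorem exists_isRegularizedInitial {γ T τ s α h C : ℝ} (hγ : γ ∈ Ioo (0 : ℝ) 1) (hT : 0 < T)
    (hτ : 0 < τ) (hα : 0 ≤ α) (hh0 : 0 ≤ h) (hh : h ≤ 1 / 2)
    (hweight : 0 < α → ∀ z : ℝ, 0 ≤ z → (1 + z ^ 2) * Real.exp (-τ * (α * z) ^ s) ≤ C)
    {ψ : ℝ → ℝ → ℝ} (hψ : IsApproxSymbol n γ T h ψ) {g gδ : L2 n} {u : ℝ → L2 n}
    (hu : IsSolution γ T g u) (hgα : α = 0 → g = gδ) :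
    ∃ v : L2 n, IsRegularizedInitial τ s T α ψ gδ v := by
  have hΓ := Real.Gamma_pos_of_pos (show 0 < 1 - γ by linarith [hγ.2])
  set D := 2 * (1 + Real.Gamma (1 - γ) * T ^ γ) with hD
  have hD0 : 0 < D := by positivity
  refine exists_fourierHat_ae_eq (V := regularizedHat τ s T α ψ gδ) ?_
  have hmeas : AEStronglyMeasurable (regularizedHat τ s T α ψ gδ) volume := by
    refine AEStronglyMeasurable.mul (Measurable.aestronglyMeasurable ?_) ?_
    · unfold kernelHat
      fun_prop
    · refine (memLp_fourierHat gδ).aestronglyMeasurable.aemeasurable.div ?_ |>.aestronglyMeasurable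
      exact (hψ.aestronglyMeasurable T ⟨hT, le_rfl⟩).aemeasurable.complex_ofReal
  have hdiff : MemLp (fun ξ => fourierHat (u 0) ξ - regularizedHat τ s T α ψ gδ ξ) 2 volume := by
    refine MemLp.mono' (g := fun ξ : Rn n => 2 * ‖fourierHat (u 0) ξ‖ +
      D * C * ‖fourierHat (g - gδ) ξ‖) (((memLp_fourierHat (u 0)).norm.const_mul 2).add
        ((memLp_fourierHat (g - gδ)).norm.const_mul (D * C)))
      ((memLp_fourierHat (u 0)).aestronglyMeasurable.sub hmeas) ?_
    filter_upwards [ae_fourierHat_sub_eq_zero α hgα,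
      ae_norm_sub_regularizedHat_le (s := s) hγ hT hτ hα hh0 hh hψ gδ hu] with ξ h0 h1
    refine h1.trans (add_le_add ?_ ?_)
    · have := Real.exp_pos (-τ * (α * ‖ξ‖) ^ s)
      gcongr
      linarith
    · rcases hα.eq_or_lt with hα0 | hα0
      · simp [h0 hα0.symm]
      · gcongr
        exact hweight hα0 _ (norm_nonneg ξ)
  have := (memLp_fourierHat (u 0)).sub hdiff
  simpa [Pi.sub_def] using this

/-- The powers of the parameter choice `α = a ^ (1 / (p + 2))`, where `a = h + δ / E`. -/
theorem error_bound_le {τ p l h δ E M D C : ℝ} (hp : 0 < p) (hl : 0 ≤ l)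
    (hlp : l ≤ p) (hE : 0 < E) (hδ : 0 ≤ δ) (hM : 0 ≤ M) (hδM : δ ≤ M * E) (hh0 : 0 ≤ h)
    (hh : h ≤ 1 / 2) (hD : 0 ≤ D) (hC : 0 ≤ C) :
    ((1 + τ) * ((h + δ / E) ^ (1 / (p + 2))) ^ (p - l) + 2 * h) * E +
        D * (C * ((h + δ / E) ^ (1 / (p + 2))) ^ (-(l + 2))) * δ ≤
      ((1 + τ) + 2 * (1 + M) + D * C) * E ^ ((2 + l) / (p + 2)) *
        (δ + h * E) ^ ((p - l) / (p + 2)) := by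
  set a := h + δ / E with ha
  have hp2 : 0 < p + 2 := by linarith
  have hδE : δ / E ≤ M := by rwa [div_le_iff₀ hE]
  have hδE0 : 0 ≤ δ / E := by positivity
  have ha0 : 0 ≤ a := by positivity
  have haM : a ≤ 1 + M := by linarith
  have hEa : δ + h * E = E * a := by
    rw [ha]
    field_simp
    ring
  have hq : 0 ≤ (p - l) / (p + 2) := div_nonneg (by linarith) hp2.le
  have hq' : 0 ≤ (2 + l) / (p + 2) := div_nonneg (by linarith) hp2.le
  have hqq : (p - l) / (p + 2) + (2 + l) / (p + 2) = 1 := by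
    field_simp
    ring
  have hq1 : (2 + l) / (p + 2) ≤ 1 := by linarith
  have hX : E ^ ((2 + l) / (p + 2)) * (δ + h * E) ^ ((p - l) / (p + 2)) =
      E * a ^ ((p - l) / (p + 2)) := by
    rw [hEa, Real.mul_rpow hE.le ha0, ← mul_assoc, ← Real.rpow_add hE, add_comm, hqq, Real.rpow_one]
  have hαpow : ∀ r : ℝ, (a ^ (1 / (p + 2))) ^ r = a ^ (r / (p + 2)) := fun r => by
    rw [← Real.rpow_mul ha0, one_div_mul_eq_div]
  rw [mul_assoc _ (E ^ _), hX, hαpow, hαpow]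
  set Y := a ^ ((p - l) / (p + 2)) with hY
  have hY0 : 0 ≤ Y := Real.rpow_nonneg ha0 _
  -- The symbol error is of first order in `a`; the surplus power `a^((2+l)/(p+2))` is at most `1 +
  -- M` because `a ≤ 1 + M`.
  have h1 : h ≤ (1 + M) * Y := by
    calc h ≤ a := by linarith
      _ = Y * a ^ ((2 + l) / (p + 2)) := by
          rw [hY, ← Real.rpow_add_of_nonneg ha0 hq hq', hqq, Real.rpow_one]
      _ ≤ Y * (1 + M) := by
          gcongr
          calc a ^ ((2 + l) / (p + 2)) ≤ (1 + M) ^ ((2 + l) / (p + 2)) := by gcongr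
            _ ≤ (1 + M) ^ (1 : ℝ) := Real.rpow_le_rpow_of_exponent_le (by linarith) hq1
            _ = 1 + M := Real.rpow_one _
      _ = _ := mul_comm _ _
  have h2 : a ^ (-(l + 2) / (p + 2)) * δ ≤ E * Y := by
    have hδa : δ ≤ E * a := by
      rw [← hEa]
      nlinarith
    -- For `a = 0` the negative power has no meaning, but then `δ = 0`.
    rcases ha0.eq_or_lt with h0 | h0
    · have : δ = 0 := le_antisymm (by rw [← h0, mul_zero] at hδa; exact hδa) hδ
      rw [this, mul_zero]
      positivity
    · calc a ^ (-(l + 2) / (p + 2)) * δ ≤ a ^ (-(l + 2) / (p + 2)) * (E * a) := by gcongr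
        _ = E * (a ^ (-(l + 2) / (p + 2)) * a) := by ring
        _ = E * Y := by
          rw [hY, ← Real.rpow_add_one h0.ne']
          congr 2
          field_simp
          ring
  calc ((1 + τ) * Y + 2 * h) * E + D * (C * a ^ (-(l + 2) / (p + 2))) * δ
      = (1 + τ) * (E * Y) + 2 * h * E + D * C * (a ^ (-(l + 2) / (p + 2)) * δ) := by ring
    _ ≤ (1 + τ) * (E * Y) + 2 * ((1 + M) * Y) * E + D * C * (E * Y) := by gcongr
    _ = _ := by ring

end FracDiffusion

/-! ### The theorem -/

open FracDiffusion in
theorem mainTheorem2 (n : ℕ) (γ T τ s p M : ℝ) (hγ : γ ∈ Set.Ioo (0 : ℝ) 1) (hT : 0 < T)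
    (hτ : 0 < τ) (hs : 0 < s) (hp : 0 < p) (hM : 0 < M) :
    ∃ C : ℝ, 0 < C ∧
      ∀ (E δ h : ℝ) (ψ : ℝ → ℝ → ℝ) (g gδ : L2 n) (u : ℝ → L2 n),
        0 < E → 0 ≤ δ → δ ≤ M * E → 0 ≤ h → h ≤ 1 / 2 →
        IsSolution γ T g u →
        sobolevNorm p (u 0) ≤ ENNReal.ofReal E →
        ‖g - gδ‖ ≤ δ →
        IsApproxSymbol n γ T h ψ →
        ∃ v : L2 n,
          IsRegularizedInitial τ s T ((h + δ / E) ^ (1 / (p + 2))) ψ gδ v ∧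
          (∀ w : L2 n,
            IsRegularizedInitial τ s T ((h + δ / E) ^ (1 / (p + 2))) ψ gδ w → w = v) ∧
          ∀ l : ℝ, 0 ≤ l → l ≤ p → p - l ≤ s →
            sobolevNorm l (u 0 - v) ≤
              ENNReal.ofReal
                (C * E ^ ((2 + l) / (p + 2)) * (δ + h * E) ^ ((p - l) / (p + 2))) := by
  have hΓ := Real.Gamma_pos_of_pos (show 0 < 1 - γ by linarith [hγ.2])
  -- `1 + M` bounds `h + δ/E`, and hence `α`, since the exponent `1/(p+2)` is below `1`.
  obtain ⟨C, hC, hweight⟩ := exists_weight_mul_exp_le (A := 1 + M) hτ hs hp (by linarith)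
  set D := 2 * (1 + Real.Gamma (1 - γ) * T ^ γ) with hD
  have hD0 : 0 < D := by positivity
  refine ⟨(1 + τ) + 2 * (1 + M) + D * C, by positivity, ?_⟩
  intro E δ h ψ g gδ u hE hδ hδM hh0 hh hu hu0 hg hψ
  have hδE0 : 0 ≤ δ / E := by positivity
  have hδE : δ / E ≤ M := by rwa [div_le_iff₀ hE]
  set α := (h + δ / E) ^ (1 / (p + 2)) with hα_def
  have hα : 0 ≤ α := by positivity
  have hαM : α ≤ 1 + M := by
    calc α ≤ (1 + M) ^ (1 / (p + 2)) := by
          rw [hα_def]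
          gcongr
          linarith
      _ ≤ (1 + M) ^ (1 : ℝ) := Real.rpow_le_rpow_of_exponent_le (by linarith) (by
          rw [div_le_one (by linarith)]
          linarith)
      _ = 1 + M := Real.rpow_one _
  have hgα : α = 0 → g = gδ := by
    intro h0
    rw [hα_def, Real.rpow_eq_zero (by positivity) (by positivity)] at h0
    have h1 : δ / E = 0 := by linarith
    have h2 : δ = 0 := (div_eq_zero_iff.1 h1).resolve_right hE.ne'
    exact sub_eq_zero.1 (norm_le_zero_iff.1 (hg.trans h2.le))
  -- Membership in `L²` needs only the weight estimate with `l = 0`.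
  obtain ⟨v, hv⟩ := exists_isRegularizedInitial (s := s) (C := C * α ^ (-((0 : ℝ) + 2))) hγ hT hτ hα
    hh0 hh (fun hα0 z hz => by
      simpa using hweight α 0 z hα0 hαM le_rfl hp.le hz) hψ hu hgα
  refine ⟨v, hv, fun w hw => eq_of_fourierHat_ae_eq ?_, fun l hl hlp hpl => ?_⟩
  · filter_upwards [hv, hw] with ξ h1 h2
    rw [h1, h2]
  · refine (sobolevNorm_sub_le hγ hT hτ hC hlp hpl hα hh0 hh hE hδ
      (fun hα0 z hz => hweight α l z hα0 hαM hl hlp hz) hψ hu hu0 hg hgα hv).trans ?_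
    exact ENNReal.ofReal_le_ofReal
      (error_bound_le hp hl hlp hE hδ hM.le hδM hh0 hh hD0.le hC.le)
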